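/- Let $p,q\ge 1$ be integers, $g\in\mathbb C\setminus\{0\}$, $b=(b_n)$ complex numbers with $b_n=0$ for $n>p+q$, and $\zeta=\lambda^p$. Let $\psi(\lambda)=\sum_{r\in\mathbb Z+1/2}\psi_r\lambda^{-r-1/2}$ and $\bar\psi(\lambda)=\sum_r\bar\psi_r\lambda^{-r-1/2}$, $\{\psi_r,\bar\psi_s\}=\delta_{r+s,0}$, be free fermions with bare vacuum $|\Omega\rangle$ ($\psi_r|\Omega\rangle=0$ for all $r$) and Dirac vacuum $|0\rangle=\prod_{r>0}\bar\psi_r|\Omega\rangle$; let $\alpha_n=\sum_{r+s=n}{}^\circ_\circ\psi_r\bar\psi_s{}^\circ_\circ$ (normal ordering with respect to $|0\rangle$), $\partial\varphi_0(\zeta)=\frac1p\sum_{n\in\mathbb Z}\alpha_n\zeta^{-n/p-1}$ with parts $\partial\varphi_{0,-}$ ($n<0$) and $\partial\varphi_{0,+}$ ($n\ge0$), and $\langle b/g|=\langle 0|\exp\bigl(g^{-1}\sum_{n=1}^{p+q}b_n\alpha_n\bigr)$. Let $|\Phi\rangle$ be a state at the background $b$, that is, a linear functional on the space of bras that is generated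 from the bras $\langle T|\exp(g^{-1}\sum_n b_n\alpha_n)$ ($T$ running over the standard basis of the Fock space) by the right action of the bilinears $\sum_l P(l)\,{}^\circ_\circ\psi_{-l-1/2}\bar\psi_{l+d+1/2}{}^\circ_\circ$ ($d\in\mathbb Z$, $P$ a polynomial); operators act on $|\Phi\rangle$ through this right action. Suppose that $\langle b/g|\Phi\rangle\ne0$, that $|\Phi\rangle$ is decomposable, $|\Phi\rangle=\prod_{k\ge0}\bigl[\oint\frac{d\lambda}{2\pi i}\bar\psi(\lambda)\Phi_k(\lambda)\bigr]|\Omega\rangle$, where each $e^{-g^{-1}\sum_n b_n\lambda^n}\Phi_k(\lambda)$ is a formal series with finitely many positive powers of $\lambda$, with leading term $\lambda^{k+c}$ for all large $k$ and some fixed $c\in\mathbb Z$, and that $|\Phi\rangle$ satisfies the $W_{1+\infty}$ constraints $W^s_n|\Phi\rangle=0$ for $s\ge1$, $n\ge-s+1$. Here $W^s_n=\sum_{a=0}^{p-1}\oint\frac{d\zeta}{2\pi i}\,s\,\zeta^{n+s-1}:\!\partial^{s-1}c_a(\zeta)\,\bar c_a(\zeta)\!:$ with $c_0(\zeta)=(d\lambda/d\zeta)^{1/2}\psi(\lambda)$,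 $\bar c_0(\zeta)=(d\lambda/d\zeta)^{1/2}\bar\psi(\lambda)$, $c_a(\zeta)=c_0(e^{2\pi ia}\zeta)$, $\bar c_a(\zeta)=\bar c_0(e^{2\pi ia}\zeta)$, and $:\ :$ is the normal ordering of the $\zeta$ plane, which subtracts $1/(\zeta_1-\zeta_2)$ from $c_a(\zeta_1)\bar c_a(\zeta_2)$ and $1/(\zeta_1-\zeta_2)^2$ from $\partial\varphi_0(\zeta_1)\partial\varphi_0(\zeta_2)$, $|\zeta_1|>|\zeta_2|$ (products of more factors by Wick's rule). Define connected microscopic-loop amplitudes $\langle\mathcal O_{n_1}\cdots\mathcal O_{n_N}\rangle_{\rm c}$ ($n_i\ge1$) as the derivatives at $j=0$ of $\ln\bigl(\langle b/g|e^{\sum_{n\ge1}j_n\alpha_n}|\Phi\rangle/\langle b/g|\Phi\rangle\bigr)$, and connected macroscopic-loop amplitudes by $$\langle\mathcal O(\zeta_1)\cdots\mathcal O(\zeta_N)\rangle_{\rm c}=\frac1{p^N}\sum_{n_1,\dots,n_N\ge1}\langle\mathcal O_{n_1}\cdots\mathcal O_{n_N}\rangle_{\rm c}\prod_i\zeta_i^{-n_i/p-1}+\delta_{N,1}\,g^{-1}N_1(\zeta_1)+\delta_{N,2}\,N_2(\zeta_1,\zeta_2),$$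 $$N_1(\zeta)=\frac1p\sum_{n=1}^{p+q}nb_n\zeta^{n/p-1},\qquad N_2(\zeta_1,\zeta_2)=\frac{d\zeta_1^{1/p}}{d\zeta_1}\frac{d\zeta_2^{1/p}}{d\zeta_2}\frac1{(\zeta_1^{1/p}-\zeta_2^{1/p})^2}-\frac1{(\zeta_1-\zeta_2)^2}.$$ For a source $j(\zeta)=\sum_k J_k\zeta^{k/p}$ (finite sum, $k\in\mathbb Z$, $J_k\in\mathbb C$) let $\oint$ run $p$ times around the origin (double integrals with $|\zeta_1|>|\zeta_2|$), and let $Z[tj]=\bigl\langle\exp\bigl(t\oint\frac{d\zeta}{2\pi i}j(\zeta)\mathcal O(\zeta)\bigr)\bigr\rangle=\exp\Bigl(\sum_{N\ge1}\frac{t^N}{N!}\oint\!\cdots\!\oint\prod_i\frac{d\zeta_i}{2\pi i}j(\zeta_i)\,\langle\mathcal O(\zeta_1)\cdots\mathcal O(\zeta_N)\rangle_{\rm c}\Bigr)$. Then, for every such $j$, as formal power series in $t$: 1. $\displaystyle Z[tj]=\frac{\langle b/g|:\!\exp\bigl(t\oint\frac{d\zeta}{2\pi i}j(\zeta)\partial\varphi_0(\zeta)\bigr)\!:|\Phi\rangle}{\langle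 b/g|\Phi\rangle}$. 2. $N_2$ comes from the change of normal ordering: on the above space of bras, $$:\!e^{t\oint\frac{d\zeta}{2\pi i}j\,\partial\varphi_0}\!:\;=\;\exp\Bigl(\frac{t^2}2\oint\!\!\oint\frac{d\zeta_1}{2\pi i}\frac{d\zeta_2}{2\pi i}\,j(\zeta_1)j(\zeta_2)N_2(\zeta_1,\zeta_2)\Bigr)\;e^{t\oint\frac{d\zeta}{2\pi i}j\,\partial\varphi_{0,-}}\;e^{t\oint\frac{d\zeta}{2\pi i}j\,\partial\varphi_{0,+}}.$$ 3. $N_1$ comes from the coherent state: $\displaystyle\langle b/g|\,e^{t\oint\frac{d\zeta}{2\pi i}j\,\partial\varphi_{0,-}}=\exp\Bigl(t\,g^{-1}\oint\frac{d\zeta}{2\pi i}j(\zeta)N_1(\zeta)\Bigr)\langle b/g|$. -/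

import Mathlib

noncomputable section

namespace MinimalString

open scoped Nat

/-! ### The fermion Fock space

Semi-infinite wedges are labelled by the set of occupied powers of `λ`: the label `k : ℤ` stands
for `λ ^ k`, created by the mode `ψ̄_{k+1/2}` and annihilated by `ψ_{-(k+1/2)}`. -/

/-- A basis state `ψ̄_{k₀+1/2} ψ̄_{k₁+1/2} ⋯ |Ω⟩` (`k₀ < k₁ < ⋯`) of the fermion Fock space, given
by its set of labels `{k₀, k₁, …}`, which differs from `{0, 1, 2, …}` in finitely many places. -/
@[ext]
structure Maya where
  carrier : Set ℤ
  finite_holes : {k : ℤ | 0 ≤ k ∧ k ∉ carrier}.Finite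
  finite_particles : {k : ℤ | k < 0 ∧ k ∈ carrier}.Finite

namespace Maya

/-- Add the label `k`. -/
def insert (S : Maya) (k : ℤ) : Maya where
  carrier := S.carrier ∪ {k}
  finite_holes := S.finite_holes.subset fun _ hj => ⟨hj.1, fun h => hj.2 (Or.inl h)⟩
  finite_particles := (S.finite_particles.union (Set.finite_singleton k)).subset fun _ hj =>
    hj.2.elim (fun h => Or.inl ⟨hj.1, h⟩) Or.inr

/-- Remove the label `k`. -/
def erase (S : Maya) (k : ℤ) : Maya where
  carrier := S.carrier \ {k}
  finite_holes := (S.finite_holes.union (Set.finite_singleton k)).subset fun j hj => by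
    by_cases h : j = k
    · exact Or.inr h
    · exact Or.inl ⟨hj.1, fun h' => hj.2 ⟨h', h⟩⟩
  finite_particles := S.finite_particles.subset fun _ hj => ⟨hj.1, hj.2.1⟩

/-- The labels `{m, m + 1, m + 2, …}`. -/
def sea (m : ℤ) : Maya where
  carrier := Set.Ici m
  finite_holes := (Set.finite_Ico 0 m).subset fun _ hj => ⟨hj.1, not_le.mp hj.2⟩
  finite_particles := (Set.finite_Ico m 0).subset fun _ hj => ⟨hj.2, hj.1⟩

/-- The sign picked up when `λ ^ k` is moved to its place in the ordered wedge. -/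
def sgn (S : Maya) (k : ℤ) : ℂ := (-1) ^ Set.ncard {j : ℤ | j ∈ S.carrier ∧ j < k}

end Maya

/-- Formal (possibly infinite) linear combinations of basis states, used both for kets
`∑ f S • |S⟩` and for bras `∑ f S • ⟨S|`. -/
abbrev Formal : Type := Maya → ℂ

/-- The basis vector `|S⟩` or `⟨S|`. -/
def basisVec (S : Maya) : Formal :=
  open Classical in fun T => if T = S then 1 else 0

/-- Wedge multiplication by `λ ^ k`. On kets this is `|Φ⟩ ↦ ψ̄_{k+1/2} |Φ⟩`;
on bras it is `⟨β| ↦ ⟨β| ψ_{-(k+1/2)}`. -/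
def wedgeMul (k : ℤ) (f : Formal) : Formal :=
  open Classical in fun T => if k ∈ T.carrier then T.sgn k * f (T.erase k) else 0

/-- Contraction with `λ ^ k`. On kets this is `|Φ⟩ ↦ ψ_{-(k+1/2)} |Φ⟩`;
on bras it is `⟨β| ↦ ⟨β| ψ̄_{k+1/2}`. -/
def contract (k : ℤ) (f : Formal) : Formal :=
  open Classical in fun T => if k ∈ T.carrier then 0 else T.sgn k * f (T.insert k)

/-- The right action `⟨β| ↦ ⟨β| ⦂ψ_{-(l+1/2)} ψ̄_{k+1/2}⦂` on bras; the normal ordering subtracts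
the expectation value in the Dirac vacuum, which is `1` for `l = k < 0` and `0` otherwise. -/
def normalOrd (l k : ℤ) (β : Formal) : Formal :=
  contract k (wedgeMul l β) - if l = k ∧ k < 0 then β else 0

theorem normalOrd_add (l k : ℤ) (β γ : Formal) :
    normalOrd l k (β + γ) = normalOrd l k β + normalOrd l k γ := by
  funext S
  simp only [normalOrd, contract, wedgeMul, Pi.add_apply, Pi.sub_apply]
  split_ifs <;> simp <;> ring

theorem normalOrd_smul (l k : ℤ) (c : ℂ) (β : Formal) :
    normalOrd l k (c • β) = c • normalOrd l k β := by
  funext S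
  simp only [normalOrd, contract, wedgeMul, Pi.smul_apply, Pi.sub_apply, smul_eq_mul]
  split_ifs <;> simp <;> ring

/-- Only finitely many terms of a bilinear of given degree contribute to a given coefficient. -/
theorem normalOrd_support_finite (d : ℤ) (S : Maya) :
    {l : ℤ | ∃ β : Formal, normalOrd l (l + d) β S ≠ 0}.Finite := by
  have h1 := S.finite_holes
  have h2 := S.finite_particles
  have h3 : {l : ℤ | 0 ≤ l + d ∧ l + d ∉ S.carrier}.Finite :=
    h1.preimage (f := fun l => l + d) (add_left_injective d).injOn
  refine (((h1.union h2).union h3).union (Set.finite_Ico 0 (-d))).subset ?_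
  rintro l ⟨β, hl⟩
  by_contra hcon
  simp only [Set.mem_union, Set.mem_ofPred_eq, Set.mem_Ico, not_or, not_and, not_not, not_lt] at hcon
  obtain ⟨⟨⟨c1, c2⟩, c3⟩, c4⟩ := hcon
  apply hl
  by_cases hd : d = 0
  · subst hd
    simp only [add_zero, normalOrd, contract, wedgeMul, Pi.sub_apply]
    by_cases hneg : l < 0
    · have hns := c2 hneg
      have e : (S.insert l).erase l = S := by
        ext j
        simp only [Maya.insert, Maya.erase, Set.mem_sdiff, Set.mem_union, Set.mem_singleton_iff]
        constructor
        · rintro ⟨h | h, h'⟩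
          · exact h
          · exact absurd h h'
        · intro h
          exact ⟨Or.inl h, fun hj => hns (hj ▸ h)⟩
      have hsg : (S.insert l).sgn l = S.sgn l := by
        unfold Maya.sgn
        congr 2
        ext j
        simp only [Maya.insert, Set.mem_union, Set.mem_singleton_iff, Set.mem_ofPred_eq]
        constructor
        · rintro ⟨h | h, h'⟩
          · exact ⟨h, h'⟩
          · omega
        · rintro ⟨h, h'⟩
          exact ⟨Or.inl h, h'⟩
      have hm : l ∈ (S.insert l).carrier := Or.inr rfl
      have hs : S.sgn l * S.sgn l = 1 := by
        unfold Maya.sgn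
        rw [← pow_add, ← two_mul, pow_mul]
        simp
      rw [if_neg hns, if_pos hm, e, hsg, if_pos (c := True ∧ l < 0) ⟨trivial, hneg⟩, ← mul_assoc, hs]
      simp
    · rw [if_pos (c1 (not_lt.mp hneg)), if_neg (fun h => hneg h.2)]
      simp
  · simp only [normalOrd, contract, wedgeMul, Pi.sub_apply]
    rw [if_neg (c := l = l + d ∧ l + d < 0) (fun h => hd (by omega))]
    by_cases hk : l + d ∈ S.carrier
    · simp [hk]
    · have hlS : l ∉ (S.insert (l + d)).carrier := by
        rintro (h | h)
        · by_cases h0 : l < 0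
          · exact c2 h0 h
          · by_cases h5 : 0 ≤ l + d
            · exact hk (c3 h5)
            · have := c4 (not_lt.mp h0)
              omega
        · exact hd (by simpa using h)
      simp [hk, hlS]

/-- The right action on bras of the fermion bilinear
`∑ₗ P(l) ⦂ψ_{-(l+1/2)} ψ̄_{l+d+1/2}⦂`, where `P` is a polynomial. These are the modes
`∮ dλ/(2πi) ⦂(P(λ∂)ψ)(λ) ψ̄(λ)⦂ λ^d`, i.e. the bilinears built from Laurent-polynomial
differential operators. -/
def bilinear (d : ℤ) (P : Polynomial ℂ) : Formal →ₗ[ℂ] Formal where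
  toFun β := fun S => ∑ᶠ l : ℤ, P.eval (l : ℂ) * normalOrd l (l + d) β S
  map_add' β γ := by
    funext S
    have hfin : ∀ δ : Formal,
        (Function.support fun l : ℤ => P.eval (l : ℂ) * normalOrd l (l + d) δ S).Finite :=
      fun δ => (normalOrd_support_finite d S).subset fun l hl => ⟨δ, right_ne_zero_of_mul hl⟩
    simp only [normalOrd_add, Pi.add_apply, mul_add]
    exact finsum_add_distrib (hfin β) (hfin γ)
  map_smul' c β := by
    funext S
    simp only [normalOrd_smul, Pi.smul_apply, smul_eq_mul, RingHom.id_apply]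
    rw [mul_finsum]
    exact finsum_congr fun l => by ring

/-! ### Coherent bras, kets and their pairing -/

/-- The right action on bras of `g⁻¹ ∑_{n=1}^{p+q} b_n α_n`, where
`α_n = ∑_{r+s=n} ⦂ψ_r ψ̄_s⦂` is `bilinear n 1`. -/
def background (p q : ℕ) (g : ℂ) (b : ℕ → ℂ) : Formal →ₗ[ℂ] Formal :=
  g⁻¹ • ∑ n ∈ Finset.Icc 1 (p + q), b n • bilinear (n : ℤ) 1

/-- The bra `⟨T| exp(g⁻¹ ∑_{n=1}^{p+q} b_n α_n)`. Each coefficient is a finite sum, since every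
`α_n` with `n ≥ 1`, acting to the right, raises the level of a bra. -/
def expBra (p q : ℕ) (g : ℂ) (b : ℕ → ℂ) (T : Maya) : Formal :=
  fun S => ∑ᶠ k : ℕ, ((k ! : ℂ))⁻¹ * ((background p q g b ^ k) (basisVec T)) S

/-- The space of bras at the background `b`: the smallest space of formal bras that contains all
`⟨T| exp(g⁻¹ ∑ b_n α_n)` and is stable under the right action of the bilinears. -/
def braSpace (p q : ℕ) (g : ℂ) (b : ℕ → ℂ) : Submodule ℂ Formal :=
  sInf {N | (∀ T, expBra p q g b T ∈ N) ∧ ∀ d P, ∀ β ∈ N, bilinear d P β ∈ N}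

/-- `⟨T| exp(g⁻¹ ∑ b_n α_n)` as an element of the space of bras. -/
def coherentBra (p q : ℕ) (g : ℂ) (b : ℕ → ℂ) (T : Maya) : braSpace p q g b :=
  ⟨expBra p q g b T, Submodule.mem_sInf.mpr fun _ hN => hN.1 T⟩

/-- The bra `⟨b/g| = ⟨0| exp(g⁻¹ ∑_{n=1}^{p+q} b_n α_n)`. -/
def bgBra (p q : ℕ) (g : ℂ) (b : ℕ → ℂ) : braSpace p q g b := coherentBra p q g b (Maya.sea 0)

/-- The bilinears acting from the right on the space of bras. Since operators act on bras from
the right, the operator product `X Y` is `Y * X` in `Module.End`. -/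
def bilinearOn (p q : ℕ) (g : ℂ) (b : ℕ → ℂ) (d : ℤ) (P : Polynomial ℂ) :
    Module.End ℂ (braSpace p q g b) :=
  (bilinear d P).restrict fun β hβ => Submodule.mem_sInf.mpr fun N hN =>
    hN.2 d P β (Submodule.mem_sInf.mp hβ N hN)

/-- The bosonic oscillator `α_n`, i.e. the coefficient of `λ^(-n-1)` in `∂φ(λ) = ⦂ψ(λ) ψ̄(λ)⦂`. -/
def alpha (p q : ℕ) (g : ℂ) (b : ℕ → ℂ) (n : ℤ) : Module.End ℂ (braSpace p q g b) :=
  bilinearOn p q g b n 1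

/-- Kets at the background `b`: the states `|Φ⟩` that can be paired with the bras at this
background. Then `|Φ⟩` amounts to the formal state `exp(g⁻¹ ∑ b_n α_n) |Φ⟩`, whose coefficient
at `|T⟩` is `⟨T| exp(g⁻¹ ∑ b_n α_n) |Φ⟩`, while `⟨0|Φ⟩` itself need not make sense. -/
abbrev Ket (p q : ℕ) (g : ℂ) (b : ℕ → ℂ) : Type := Module.Dual ℂ (braSpace p q g b)

/-! ### Decomposable states -/

/-- The action `|Φ⟩ ↦ ∮ dλ/(2πi) ψ̄(λ) h(λ) |Φ⟩ = ∑ₖ h_k ψ̄_{k+1/2} |Φ⟩` on formal kets, for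
`h(λ) = ∑ₖ h_k λ^k` with `h_k = 0` for large `k` (each coefficient is then a finite sum). -/
def psiBar (h : ℤ → ℂ) (f : Formal) : Formal := fun T => ∑ᶠ k : ℤ, h k * wedgeMul k f T

/-- The state `ψ̄(h₀) ψ̄(h₁) ⋯ ψ̄(h_{n-1}) ∏_{k ≥ n+c} ψ̄_{k+1/2} |Ω⟩`, where
`ψ̄(h) = ∮ dλ/(2πi) ψ̄(λ) h(λ)`. -/
def partialProduct (h : ℕ → ℤ → ℂ) (c : ℤ) (n : ℕ) : Formal :=
  (List.range n).foldr (fun i f => psiBar (h i) f) (basisVec (Maya.sea (n + c)))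

/-- `|Φ⟩` is decomposable: the formal state `exp(g⁻¹ ∑ b_n α_n) |Φ⟩` is an infinite product
`∏_{k ≥ 0} [∮ dλ/(2πi) ψ̄(λ) h_k(λ)] |Ω⟩`, where each `h_k` is a formal series with finitely many
positive powers of `λ` and `h_k = λ^(k+c) + (lower powers)` for large `k`. The coefficients of the
infinite product are the eventually constant ones of the products of the first `n` factors.
As `exp(β·α) ψ̄(λ) exp(-β·α) = exp(-∑ β_n λ^n) ψ̄(λ)`, this says that
`|Φ⟩ = ∏_{k ≥ 0} [∮ dλ/(2πi) ψ̄(λ) Φ_k(λ)] |Ω⟩` with `Φ_k = exp(g⁻¹ ∑ b_n λ^n) h_k`. -/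
def IsDecomposable {p q : ℕ} {g : ℂ} {b : ℕ → ℂ} (Φ : Ket p q g b) : Prop :=
  ∃ (h : ℕ → ℤ → ℂ) (c : ℤ),
    (∀ k, ∃ M : ℤ, ∀ j, M < j → h k j = 0) ∧
    (∀ᶠ k in Filter.atTop, h k (k + c) = 1 ∧ ∀ j, (k : ℤ) + c < j → h k j = 0) ∧
    ∀ T : Maya, ∀ᶠ n in Filter.atTop, Φ (coherentBra p q g b T) = partialProduct h c n T

/-! ### The `W_{1+∞}` constraints

With `ζ = λ^p`, `c₀(ζ) = (dλ/dζ)^{1/2} ψ(λ)`, `c̄₀(ζ) = (dλ/dζ)^{1/2} ψ̄(λ)`, and the normal ordering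
`:c₀(ζ₁) c̄₀(ζ₂): = c₀(ζ₁) c̄₀(ζ₂) - 1/(ζ₁-ζ₂)` of the `ζ` plane, the generators are
`W^s_n = ∑ₐ ∮ dζ/(2πi) s ζ^{n+s-1} :∂^{s-1}cₐ(ζ) c̄ₐ(ζ):`, where the sum over the `p` sheets
turns `∮` into an integral around the origin of the `λ` plane. Now
`∂^{s-1}[(dλ/dζ)^{1/2} λ^l] = p^{-1/2} ν(ν-1)⋯(ν-s+2) ζ^{ν-s+1}` with `ν = (l + (1-p)/2)/p`, and
`:c₀(ζ₁) c̄₀(ζ₂): = (λ₁' λ₂')^{1/2} ⦂ψ(λ₁) ψ̄(λ₂)⦂ + [(λ₁' λ₂')^{1/2}/(λ₁-λ₂) - 1/(ζ₁-ζ₂)]`. -/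

/-- The polynomial `s ν(ν-1)⋯(ν-s+2)` in `l`, where `ν = (l + (1-p)/2)/p`. -/
def wSymbol (p s : ℕ) : Polynomial ℂ :=
  Polynomial.C (s : ℂ) * (descPochhammer ℂ (s - 1)).comp
    (Polynomial.C ((p : ℂ)⁻¹) * (Polynomial.X + Polynomial.C ((1 - (p : ℂ)) / 2)))

/-- The binomial series `(1 + u)^y`. -/
def binom (y : ℂ) : PowerSeries ℂ :=
  PowerSeries.mk fun k => (descPochhammer ℂ k).eval y / (k ! : ℂ)

/-- The series `(ζ₁-ζ₂) (λ₁' λ₂')^{1/2} / (λ₁-λ₂)` in `u`, where `ζ₁ = ζ₂ (1 + u)`; explicitly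
`p⁻¹ (1+u)^{(1/p-1)/2} · u / ((1+u)^{1/p} - 1)`. -/
def contractionSeries (p : ℕ) : PowerSeries ℂ :=
  PowerSeries.C ((p : ℂ)⁻¹) * binom (((p : ℂ)⁻¹ - 1) / 2) *
    (PowerSeries.mk fun k => PowerSeries.coeff (k + 1) (binom ((p : ℂ)⁻¹)))⁻¹

/-- The contribution of the change of normal ordering to `W^s_0`. -/
def wConst (p s : ℕ) : ℂ := (p : ℂ) * (s ! : ℂ) * PowerSeries.coeff s (contractionSeries p)

/-- The generator `W^s_n` of `W_{1+∞}` (for `s ≥ 1`). -/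
def W (p q : ℕ) (g : ℂ) (b : ℕ → ℂ) (s : ℕ) (n : ℤ) : Module.End ℂ (braSpace p q g b) :=
  bilinearOn p q g b (n * p) (wSymbol p s) + (if n = 0 then wConst p s else 0) • 1

/-- The `W_{1+∞}` constraints `W^s_n |Φ⟩ = 0` for `s ≥ 1` and `n ≥ -s + 1`. -/
def SatisfiesW {p q : ℕ} {g : ℂ} {b : ℕ → ℂ} (Φ : Ket p q g b) : Prop :=
  ∀ (s : ℕ) (n : ℤ), 1 ≤ s → -(s : ℤ) + 1 ≤ n → Φ ∘ₗ W p q g b s n = 0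

/-! ### Sources and contour integrals

Functions of `ζ` on the `p`-sheeted cover are written as functions of `λ = ζ^{1/p}`. -/

/-- The source `j(ζ) = ∑ₖ J_k ζ^{k/p}` as a function of `λ = ζ^{1/p}`. -/
def source (j : ℤ →₀ ℂ) (z : ℂ) : ℂ := j.sum fun k c => c * z ^ k

/-- The contour integral `∮ dζ/(2πi) f` surrounding the origin of the `ζ` plane `p` times, with
`|λ| = R`; `f` is given as a function of `λ`. -/
def oint (p : ℕ) (R : ℝ) (f : ℂ → ℂ) : ℂ :=
  (2 * Real.pi * Complex.I)⁻¹ * ∮ z in C(0, R), (p : ℂ) * z ^ (p - 1) * f z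

/-- `∮ dζ₁/(2πi) dζ₂/(2πi) j(ζ₁) j(ζ₂) K(ζ₁, ζ₂)` with `|λ₁| = R₁` and `|λ₂| = R₂`. -/
def oint₂ (p : ℕ) (R₁ R₂ : ℝ) (j : ℤ →₀ ℂ) (K : ℂ → ℂ → ℂ) : ℂ :=
  oint p R₁ fun z => oint p R₂ fun w => source j z * source j w * K z w

/-- `∮ dζ/(2πi) j(ζ) (1/p) ζ^{-n/p-1}`. -/
def sourceMode (p : ℕ) (R : ℝ) (j : ℤ →₀ ℂ) (n : ℤ) : ℂ :=
  oint p R fun z => source j z * ((p : ℂ)⁻¹ * z ^ (-n - (p : ℤ)))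

/-- The disk term `N₁(ζ) = (1/p) ∑_{n=1}^{p+q} n b_n ζ^{n/p-1}`. -/
def N₁ (p q : ℕ) (b : ℕ → ℂ) (z : ℂ) : ℂ :=
  (p : ℂ)⁻¹ * ∑ n ∈ Finset.Icc 1 (p + q), (n : ℂ) * b n * z ^ ((n : ℤ) - (p : ℤ))

/-- The derivative `dζ^{1/p}/dζ = (1/p) ζ^{1/p-1}`. -/
def dRoot (p : ℕ) (z : ℂ) : ℂ := (p : ℂ)⁻¹ * z ^ (1 - (p : ℤ))

/-- The annulus term
`N₂(ζ₁, ζ₂) = (dζ₁^{1/p}/dζ₁) (dζ₂^{1/p}/dζ₂) / (ζ₁^{1/p} - ζ₂^{1/p})² - 1/(ζ₁ - ζ₂)²`. -/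
def N₂ (p : ℕ) (z w : ℂ) : ℂ :=
  dRoot p z * dRoot p w / (z - w) ^ 2 - 1 / (z ^ p - w ^ p) ^ 2

/-! ### Microscopic loops -/

/-- `⟨b/g| α_{n₁} ⋯ α_{n_N} |Φ⟩ / ⟨b/g|Φ⟩`. -/
def microCorr {p q : ℕ} {g : ℂ} {b : ℕ → ℂ} (Φ : Ket p q g b) (w : List ℕ+) : ℂ :=
  Φ (w.foldl (fun β n => alpha p q g b (n : ℤ) β) (bgBra p q g b)) / Φ (bgBra p q g b)

/-- The generating function `⟨b/g| exp(∑_{n ≥ 1} j_n α_n) |Φ⟩ / ⟨b/g|Φ⟩` of microscopic-loop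
amplitudes, as a formal power series in `j₁, j₂, …`: the coefficient of a monomial is the sum
over all words in the `j_n α_n` with this content. -/
def microZ {p q : ℕ} {g : ℂ} {b : ℕ → ℂ} (Φ : Ket p q g b) : MvPowerSeries ℕ+ ℂ :=
  fun m => ∑ᶠ (w : List ℕ+) (_ : (w : Multiset ℕ+) = Finsupp.toMultiset m),
    ((w.length ! : ℂ))⁻¹ * microCorr Φ w

/-- `F(j) = ln Z(j)`. -/
def microF {p q : ℕ} {g : ℂ} {b : ℕ → ℂ} (Φ : Ket p q g b) : MvPowerSeries ℕ+ ℂ :=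
  (PowerSeries.log ℂ).subst (microZ Φ - 1)

/-- The connected microscopic-loop amplitude `⟨O_{n₁} ⋯ O_{n_N}⟩_c`, the derivative of `F` with
respect to `j_{n₁}, …, j_{n_N}` at `j = 0`. -/
def microConn {p q : ℕ} {g : ℂ} {b : ℕ → ℂ} (Φ : Ket p q g b) {N : ℕ} (n : Fin N → ℕ+) : ℂ :=
  let m : ℕ+ →₀ ℕ := ∑ i, Finsupp.single (n i) 1
  (m.prod fun _ k => (k ! : ℂ)) * MvPowerSeries.coeff m (microF Φ)

/-! ### Macroscopic loops -/

/-- `∮∏ᵢ dζᵢ/(2πi) j(ζᵢ) ⟨O(ζ₁) ⋯ O(ζ_N)⟩_c` for the macroscopic-loop amplitudes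
`⟨O(ζ₁) ⋯ O(ζ_N)⟩_c = p^{-N} ∑_{n₁,…,n_N ≥ 1} ⟨O_{n₁} ⋯ O_{n_N}⟩_c ∏ᵢ ζᵢ^{-nᵢ/p-1}`
`+ δ_{N,1} g⁻¹ N₁(ζ₁) + δ_{N,2} N₂(ζ₁, ζ₂)`. Only finitely many terms of the sum contribute for a
source with finitely many modes. -/
def macroConn {p q : ℕ} {g : ℂ} {b : ℕ → ℂ} (Φ : Ket p q g b) (R₁ R₂ : ℝ) (j : ℤ →₀ ℂ)
    (N : ℕ) : ℂ :=
  (∑ᶠ n : Fin N → ℕ+, (∏ i, sourceMode p R₁ j (n i)) * microConn Φ n) +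
    (if N = 1 then g⁻¹ * oint p R₁ (fun z => source j z * N₁ p q b z) else 0) +
    (if N = 2 then oint₂ p R₁ R₂ j (N₂ p) else 0)

/-- The generating function `Z[t j] = ⟨exp(t ∮ dζ/(2πi) j(ζ) O(ζ))⟩` of macroscopic-loop
amplitudes, as a power series in `t`; it is the exponential of
`∑_{N ≥ 1} t^N/N! ∮⋯∮ j(ζ₁) ⋯ j(ζ_N) ⟨O(ζ₁) ⋯ O(ζ_N)⟩_c`. -/
def macroZ {p q : ℕ} {g : ℂ} {b : ℕ → ℂ} (Φ : Ket p q g b) (R₁ R₂ : ℝ) (j : ℤ →₀ ℂ) :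
    PowerSeries ℂ :=
  (PowerSeries.exp ℂ).subst
    (PowerSeries.mk fun N => if N = 0 then 0 else macroConn Φ R₁ R₂ j N / (N ! : ℂ))

/-! ### The smeared boson and its normal orderings -/

/-- `∮ dζ/(2πi) j(ζ) ∂φ₀(ζ)` with `∂φ₀(ζ) = (1/p) ∑_{n ∈ ℤ} α_n ζ^{-n/p-1}`. Only finitely many
modes contribute, and the result does not depend on the radius. -/
def smeared (p q : ℕ) (g : ℂ) (b : ℕ → ℂ) (R : ℝ) (j : ℤ →₀ ℂ) :
    Module.End ℂ (braSpace p q g b) :=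
  ∑ᶠ n : ℤ, sourceMode p R j n • alpha p q g b n

/-- The creation part `∮ dζ/(2πi) j(ζ) ∂φ_{0,-}(ζ)`, containing the modes `n < 0`. -/
def smearedNeg (p q : ℕ) (g : ℂ) (b : ℕ → ℂ) (R : ℝ) (j : ℤ →₀ ℂ) :
    Module.End ℂ (braSpace p q g b) :=
  ∑ᶠ (n : ℤ) (_ : n < 0), sourceMode p R j n • alpha p q g b n

/-- The annihilation part `∮ dζ/(2πi) j(ζ) ∂φ_{0,+}(ζ)`, containing the modes `n ≥ 0` (those
that annihilate the Dirac vacuum). -/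
def smearedPos (p q : ℕ) (g : ℂ) (b : ℕ → ℂ) (R : ℝ) (j : ℤ →₀ ℂ) :
    Module.End ℂ (braSpace p q g b) :=
  ∑ᶠ (n : ℤ) (_ : 0 ≤ n), sourceMode p R j n • alpha p q g b n

/-- The normal-ordered powers `:A^n:` of a linear field `A` with self-contraction `κ`, by Wick's
rule `:A^{n+2}: = A :A^{n+1}: - (n+1) κ :A^n:`. -/
def wickPow {V : Type*} [AddCommGroup V] [Module ℂ V] (A : Module.End ℂ V) (κ : ℂ) :
    ℕ → Module.End ℂ V
  | 0 => 1
  | 1 => A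
  | n + 2 => A * wickPow A κ (n + 1) - ((n + 1 : ℂ) * κ) • wickPow A κ n

/-- `:exp(t ∮ dζ/(2πi) j(ζ) ∂φ₀(ζ)):` as a power series in `t`, where `: :` is the normal ordering
with respect to the vacuum that is invariant under `SL(2, ℂ)` on the `ζ` plane: it subtracts from
radially ordered products the contraction `1/(ζ₁ - ζ₂)²` of `∂φ₀(ζ₁) ∂φ₀(ζ₂)`, `|ζ₁| > |ζ₂|`. -/
def zetaExp (p q : ℕ) (g : ℂ) (b : ℕ → ℂ) (R₁ R₂ : ℝ) (j : ℤ →₀ ℂ) :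
    PowerSeries (Module.End ℂ (braSpace p q g b)) :=
  PowerSeries.mk fun N => ((N ! : ℂ))⁻¹ •
    wickPow (smeared p q g b R₁ j) (oint₂ p R₁ R₂ j fun z w => 1 / (z ^ p - w ^ p) ^ 2) N

/-- The exponential `exp(t A)` as a power series in `t`. -/
def expOp {V : Type*} [AddCommGroup V] [Module ℂ V] (A : Module.End ℂ V) :
    PowerSeries (Module.End ℂ V) :=
  PowerSeries.mk fun N => ((N ! : ℂ))⁻¹ • A ^ N

/-- `⦂exp(t ∮ dζ/(2πi) j(ζ) ∂φ₀(ζ))⦂ = exp(t ∮ j ∂φ_{0,-}) exp(t ∮ j ∂φ_{0,+})`, the oscillator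
normal ordering (that of the `λ` plane). The factors stand in the opposite order because
operators act on bras from the right. -/
def lambdaExp (p q : ℕ) (g : ℂ) (b : ℕ → ℂ) (R : ℝ) (j : ℤ →₀ ℂ) :
    PowerSeries (Module.End ℂ (braSpace p q g b)) :=
  expOp (smearedPos p q g b R j) * expOp (smearedNeg p q g b R j)

/-- `exp(c t²)` as a power series of operators. -/
def gaussian {V : Type*} [AddCommGroup V] [Module ℂ V] (c : ℂ) :
    PowerSeries (Module.End ℂ V) :=
  PowerSeries.map (algebraMap ℂ (Module.End ℂ V))
    ((PowerSeries.exp ℂ).subst (PowerSeries.C c * PowerSeries.X ^ 2))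

end MinimalString

end

noncomputable section

namespace MinimalString

open scoped Nat

/-! ### Canonical anticommutation relations -/

namespace Maya

/-! Everything reduces to the Heisenberg algebra of the oscillators α_n on bras. A contour integral
against a source only extracts Laurent coefficients, so the smeared boson is the finite sum Σ J_n
α_n = P + M, with P collecting the modes n ≥ 0 and M those with n < 0. The commutator [M, P] (as
right-acting operators) is a scalar σ = Σ_{n≥1} n J_n J_{-n} (`bilinear_one_commutator`,
`smeared_commutator`).

Normal ordering. Wick's recursion for :A^n: with contraction κ says that its exponential generating
function solves y' = A y - κ t y. The ordered product exp(c t²) exp(tP) exp(tM) solves y' = A y +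
(2c - σ) t y, because moving M past exp(tP) costs σt. The two agree for c = (σ - κ)/2
(`wickPow_eq`). Here κ is the integral of 1/(ζ₁ - ζ₂)², and a residue computation shows that σ is
the integral of the λ-plane double pole (`oint₂_lambda`), so σ - κ is the integral of N₂. The number
κ itself never has to be evaluated.

Coherent state. The negative modes and α_0 annihilate ⟨0|, and [α_{-n}, α_m] is a scalar, so ⟨b/g|
is an eigenbra of each α_{-n} (`bilinear_expBra`). Summing the eigenvalues against J gives the
integral of N₁. The infinite sums involved are under control because operators are row-finite and
the background raises the level of a bra.

Generating function. On the line of sources j_n = t J_n, the connected microscopic amplitudes sum to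
ln of ⟨b/g| exp(tP) |Φ⟩/⟨b/g|Φ⟩, the zero mode dropping out on ⟨b/g|. The disk term adds a linear
term in t and the annulus term a quadratic one; exponentiating turns the sum into a product of three
factors (`macroZ_factorization`), which are exactly the three factors of the ordered exponential
evaluated on ⟨b/g|. -/

theorem finite_below (S : Maya) (k : ℤ) : {j : ℤ | j ∈ S.carrier ∧ j < k}.Finite := by
  refine (S.finite_particles.union (Set.finite_Ico 0 k)).subset fun j hj => ?_
  rcases lt_or_ge j 0 with h | h
  · exact Or.inl ⟨h, hj.1⟩
  · exact Or.inr ⟨h, hj.2⟩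

theorem mem_insert {S : Maya} {k j : ℤ} : j ∈ (S.insert k).carrier ↔ j ∈ S.carrier ∨ j = k :=
  Iff.rfl

theorem mem_erase {S : Maya} {k j : ℤ} : j ∈ (S.erase k).carrier ↔ j ∈ S.carrier ∧ j ≠ k :=
  Iff.rfl

theorem sgn_insert {S : Maya} {k : ℤ} (hk : k ∉ S.carrier) (j : ℤ) :
    (S.insert k).sgn j = if k < j then -S.sgn j else S.sgn j := by
  unfold sgn
  split_ifs with h
  · have e : {i : ℤ | i ∈ (S.insert k).carrier ∧ i < j} =
        Insert.insert k {i : ℤ | i ∈ S.carrier ∧ i < j} := by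
      ext i
      simp only [mem_insert, Set.mem_ofPred_eq, Set.mem_insert_iff]
      grind
    rw [e, Set.ncard_insert_of_notMem (fun h' => hk h'.1) (S.finite_below j), pow_succ]
    ring
  · congr 2
    ext i
    simp only [mem_insert, Set.mem_ofPred_eq]
    grind

theorem insert_erase {S : Maya} {k : ℤ} (hk : k ∈ S.carrier) : (S.erase k).insert k = S := by
  ext j
  simp only [mem_insert, mem_erase]
  grind

theorem erase_insert {S : Maya} {k : ℤ} (hk : k ∉ S.carrier) : (S.insert k).erase k = S := by
  ext j
  simp only [mem_insert, mem_erase]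
  grind

theorem erase_comm (S : Maya) (k l : ℤ) : (S.erase k).erase l = (S.erase l).erase k := by
  ext j
  simp only [mem_erase]
  grind

theorem insert_comm (S : Maya) (k l : ℤ) : (S.insert k).insert l = (S.insert l).insert k := by
  ext j
  simp only [mem_insert]
  grind

theorem insert_erase_comm (S : Maya) {k l : ℤ} (h : k ≠ l) :
    (S.insert k).erase l = (S.erase l).insert k := by
  ext j
  simp only [mem_insert, mem_erase]
  grind

theorem sgn_erase {S : Maya} {k : ℤ} (hk : k ∈ S.carrier) (j : ℤ) :
    (S.erase k).sgn j = if k < j then -S.sgn j else S.sgn j := by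
  have h := sgn_insert (S := S.erase k) (k := k) (fun h => h.2 rfl) j
  rw [insert_erase hk] at h
  split_ifs at h ⊢ <;> simp [h]

theorem sgn_mul_self (S : Maya) (k : ℤ) : S.sgn k * S.sgn k = 1 := by
  unfold sgn
  rw [← pow_add, ← two_mul, pow_mul]
  simp

end Maya

/-- `wedgeMul` as a linear map. -/
def wedgeL (k : ℤ) : Module.End ℂ Formal where
  toFun := wedgeMul k
  map_add' f h := by
    funext T
    simp only [wedgeMul, Pi.add_apply]
    split_ifs <;> ring
  map_smul' c f := by
    funext T
    simp only [wedgeMul, Pi.smul_apply, smul_eq_mul, RingHom.id_apply]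
    split_ifs <;> ring

/-- `contract` as a linear map. -/
def contractL (k : ℤ) : Module.End ℂ Formal where
  toFun := contract k
  map_add' f h := by
    funext T
    simp only [contract, Pi.add_apply]
    split_ifs <;> ring
  map_smul' c f := by
    funext T
    simp only [contract, Pi.smul_apply, smul_eq_mul, RingHom.id_apply]
    split_ifs <;> ring

theorem wedgeMul_of_mem {k : ℤ} {T : Maya} (h : k ∈ T.carrier) (f : Formal) :
    wedgeMul k f T = T.sgn k * f (T.erase k) := if_pos h

theorem wedgeMul_of_notMem {k : ℤ} {T : Maya} (h : k ∉ T.carrier) (f : Formal) :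
    wedgeMul k f T = 0 := if_neg h

theorem contract_of_mem {k : ℤ} {T : Maya} (h : k ∈ T.carrier) (f : Formal) :
    contract k f T = 0 := if_pos h

theorem contract_of_notMem {k : ℤ} {T : Maya} (h : k ∉ T.carrier) (f : Formal) :
    contract k f T = T.sgn k * f (T.insert k) := if_neg h

theorem wedgeL_mul_wedgeL (k l : ℤ) : wedgeL k * wedgeL l = -(wedgeL l * wedgeL k) := by
  refine LinearMap.ext fun f => funext fun T => ?_
  change wedgeMul k (wedgeMul l f) T = -wedgeMul l (wedgeMul k f) T
  by_cases hk : k ∈ T.carrier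
  · rw [wedgeMul_of_mem hk]
    by_cases hl : l ∈ T.carrier
    · rw [wedgeMul_of_mem hl]
      rcases lt_trichotomy k l with h | rfl | h
      · rw [wedgeMul_of_mem (Maya.mem_erase.mpr ⟨hl, h.ne'⟩),
          wedgeMul_of_mem (Maya.mem_erase.mpr ⟨hk, h.ne⟩), T.erase_comm k l,
          Maya.sgn_erase hk, Maya.sgn_erase hl, if_pos h, if_neg h.not_gt]
        ring
      · rw [wedgeMul_of_notMem fun h => (Maya.mem_erase.mp h).2 rfl]
        ring
      · rw [wedgeMul_of_mem (Maya.mem_erase.mpr ⟨hl, h.ne⟩),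
          wedgeMul_of_mem (Maya.mem_erase.mpr ⟨hk, h.ne'⟩), T.erase_comm k l,
          Maya.sgn_erase hk, Maya.sgn_erase hl, if_pos h, if_neg h.not_gt]
        ring
    · rw [wedgeMul_of_notMem hl, wedgeMul_of_notMem fun h => hl (Maya.mem_erase.mp h).1]
      ring
  · rw [wedgeMul_of_notMem hk]
    by_cases hl : l ∈ T.carrier
    · rw [wedgeMul_of_mem hl, wedgeMul_of_notMem fun h => hk (Maya.mem_erase.mp h).1]
      ring
    · rw [wedgeMul_of_notMem hl, neg_zero]

theorem contractL_mul_contractL (k l : ℤ) :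
    contractL k * contractL l = -(contractL l * contractL k) := by
  refine LinearMap.ext fun f => funext fun T => ?_
  change contract k (contract l f) T = -contract l (contract k f) T
  by_cases hk : k ∈ T.carrier
  · rw [contract_of_mem hk]
    by_cases hl : l ∈ T.carrier
    · rw [contract_of_mem hl, neg_zero]
    · rw [contract_of_notMem hl, contract_of_mem (Maya.mem_insert.mpr (Or.inl hk))]
      ring
  · rw [contract_of_notMem hk]
    by_cases hl : l ∈ T.carrier
    · rw [contract_of_mem hl, contract_of_mem (Maya.mem_insert.mpr (Or.inl hl))]
      ring
    · rw [contract_of_notMem hl]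
      rcases lt_trichotomy k l with h | rfl | h
      · rw [contract_of_notMem fun h' => (Maya.mem_insert.mp h').elim hl h.ne',
          contract_of_notMem fun h' => (Maya.mem_insert.mp h').elim hk h.ne, T.insert_comm k l,
          Maya.sgn_insert hk, Maya.sgn_insert hl, if_pos h, if_neg h.not_gt]
        ring
      · rw [contract_of_mem (Maya.mem_insert.mpr (Or.inr rfl))]
        ring
      · rw [contract_of_notMem fun h' => (Maya.mem_insert.mp h').elim hl h.ne,
          contract_of_notMem fun h' => (Maya.mem_insert.mp h').elim hk h.ne', T.insert_comm k l,
          Maya.sgn_insert hk, Maya.sgn_insert hl, if_pos h, if_neg h.not_gt]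
        ring

/-- For k ≠ l, adding one label and removing the other commute on the set of labels, and exactly one
of the two orders sees an extra sign, from whichever label is smaller. For k = l exactly one of the
two products acts, and its sign is squared. -/
theorem contractL_mul_wedgeL (k l : ℤ) :
    contractL k * wedgeL l = (if k = l then 1 else 0) - wedgeL l * contractL k := by
  refine LinearMap.ext fun f => funext fun T => ?_
  rw [LinearMap.sub_apply, Pi.sub_apply]
  change contract k (wedgeMul l f) T = _ - wedgeMul l (contract k f) T
  rcases eq_or_ne k l with rfl | h
  · rw [if_pos rfl]
    change _ = f T - _
    by_cases hk : k ∈ T.carrier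
    · rw [contract_of_mem hk, wedgeMul_of_mem hk,
        contract_of_notMem fun h => (Maya.mem_erase.mp h).2 rfl, Maya.insert_erase hk,
        Maya.sgn_erase hk, if_neg (lt_irrefl k), ← mul_assoc, Maya.sgn_mul_self, one_mul, sub_self]
    · rw [contract_of_notMem hk, wedgeMul_of_notMem hk,
        wedgeMul_of_mem (Maya.mem_insert.mpr (Or.inr rfl)), Maya.erase_insert hk,
        Maya.sgn_insert hk, if_neg (lt_irrefl k), ← mul_assoc, Maya.sgn_mul_self, one_mul, sub_zero]
  · rw [if_neg h]
    change _ = 0 - _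
    by_cases hk : k ∈ T.carrier
    · rw [contract_of_mem hk]
      by_cases hl : l ∈ T.carrier
      · rw [wedgeMul_of_mem hl, contract_of_mem (Maya.mem_erase.mpr ⟨hk, h⟩)]
        ring
      · rw [wedgeMul_of_notMem hl, sub_zero]
    · rw [contract_of_notMem hk]
      by_cases hl : l ∈ T.carrier
      · rw [wedgeMul_of_mem hl, wedgeMul_of_mem (Maya.mem_insert.mpr (Or.inl hl)),
          contract_of_notMem fun h => hk (Maya.mem_erase.mp h).1, T.insert_erase_comm h,
          Maya.sgn_insert hk, Maya.sgn_erase hl]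
        rcases lt_or_gt_of_ne h with h' | h'
        · rw [if_pos h', if_neg h'.not_gt]; ring
        · rw [if_pos h', if_neg h'.not_gt]; ring
      · rw [wedgeMul_of_notMem hl,
          wedgeMul_of_notMem fun h' => (Maya.mem_insert.mp h').elim hl h.symm]
        ring

/-- `normalOrd` as a linear map. -/
def normalOrdL (l k : ℤ) : Module.End ℂ Formal where
  toFun := normalOrd l k
  map_add' := normalOrd_add l k
  map_smul' := normalOrd_smul l k

@[simp]
theorem normalOrdL_apply (l k : ℤ) (β : Formal) : normalOrdL l k β = normalOrd l k β := rfl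

theorem normalOrdL_eq (l k : ℤ) :
    normalOrdL l k = contractL k * wedgeL l - (if l = k ∧ k < 0 then (1 : ℂ) else 0) • 1 := by
  refine LinearMap.ext fun β => ?_
  change normalOrd l k β = contract k (wedgeMul l β) - _
  unfold normalOrd
  split_ifs <;> simp

/-- The normal-ordering subtractions are scalars and drop out of the commutator. Anticommuting the
two inner factors leaves one contraction in each product; the remaining quartic terms are equal,
since reordering them takes two sign changes. -/
theorem normalOrdL_commutator (l' k' l k : ℤ) :
    normalOrdL l' k' * normalOrdL l k - normalOrdL l k * normalOrdL l' k' =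
      (if l' = k then contractL k' * wedgeL l else 0) -
        if k' = l then contractL k * wedgeL l' else 0 := by
  have e : ∀ (A B : Module.End ℂ Formal) (c d : ℂ),
      (A - c • 1) * (B - d • 1) - (B - d • 1) * (A - c • 1) = A * B - B * A := by
    intro A B c d
    simp only [mul_sub, sub_mul, mul_smul_comm, smul_mul_assoc, mul_one, one_mul]
    module
  rw [normalOrdL_eq, normalOrdL_eq, e]
  have h1 : contractL k' * wedgeL l' * (contractL k * wedgeL l) =
      (if l' = k then contractL k' * wedgeL l else 0) -
        contractL k' * contractL k * (wedgeL l' * wedgeL l) := by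
    have h := contractL_mul_wedgeL k l'
    rw [eq_sub_iff_add_eq, add_comm, ← eq_sub_iff_add_eq] at h
    rw [mul_assoc, ← mul_assoc (wedgeL l'), h, sub_mul, mul_sub]
    congr 1
    split_ifs with h1 h2 h2
    · simp
    · exact absurd h1.symm h2
    · exact absurd h2.symm h1
    · simp
  have h2 : contractL k * wedgeL l * (contractL k' * wedgeL l') =
      (if k' = l then contractL k * wedgeL l' else 0) -
        contractL k * contractL k' * (wedgeL l * wedgeL l') := by
    have h := contractL_mul_wedgeL k' l
    rw [eq_sub_iff_add_eq, add_comm, ← eq_sub_iff_add_eq] at h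
    rw [mul_assoc, ← mul_assoc (wedgeL l), h, sub_mul, mul_sub]
    congr 1
    split_ifs <;> simp
  have h3 : contractL k * contractL k' * (wedgeL l * wedgeL l') =
      contractL k' * contractL k * (wedgeL l' * wedgeL l) := by
    rw [contractL_mul_contractL k k', wedgeL_mul_wedgeL l l']
    exact neg_mul_neg (contractL k' * contractL k) _
  rw [h1, h2, h3]
  abel

/-! ### Row-finite operators -/

/-- Every coefficient of `L β` depends on finitely many coefficients of `β` only. -/
def RowFinite (L : Module.End ℂ Formal) : Prop :=
  ∀ S, ∃ F : Finset Maya, ∀ β : Formal, (∀ T ∈ F, β T = 0) → L β S = 0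

/-- Row-finite operators commute with pointwise finite sums. -/
theorem RowFinite.apply_finsum {L : Module.End ℂ Formal} (hL : RowFinite L) {ι : Type*}
    {β : ι → Formal} (hβ : ∀ T, (Function.support fun i => β i T).Finite) (S : Maya) :
    (Function.support fun i => L (β i) S).Finite ∧
      L (fun T => ∑ᶠ i, β i T) S = ∑ᶠ i, L (β i) S := by
  classical
  obtain ⟨F, hF⟩ := hL S
  have hfin : (⋃ T ∈ F, Function.support fun i => β i T).Finite :=
    F.finite_toSet.biUnion fun T _ => hβ T
  have hzero : ∀ i ∉ hfin.toFinset, ∀ T ∈ F, β i T = 0 := by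
    intro i hi T hT
    by_contra h
    exact hi (hfin.mem_toFinset.mpr (Set.mem_biUnion hT h))
  have hsub : (Function.support fun i => L (β i) S) ⊆ hfin.toFinset := by
    intro i hi
    by_contra h
    exact hi (hF _ (hzero i h))
  refine ⟨hfin.toFinset.finite_toSet.subset hsub, ?_⟩
  rw [finsum_eq_sum_of_support_subset _ hsub]
  have h := hF ((fun T => ∑ᶠ i, β i T) - ∑ i ∈ hfin.toFinset, β i) fun T hT => by
    rw [Pi.sub_apply, Finset.sum_apply, sub_eq_zero]
    refine finsum_eq_sum_of_support_subset _ fun i hi => ?_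
    by_contra h
    exact hi (hzero i h T hT)
  rw [map_sub, map_sum, Pi.sub_apply, Finset.sum_apply, sub_eq_zero] at h
  exact h

theorem rowFinite_normalOrdL (l k : ℤ) : RowFinite (normalOrdL l k) := by
  classical
  intro S
  refine ⟨{S, (S.insert k).erase l}, fun β h => ?_⟩
  have h1 := h S (by simp)
  have h2 := h ((S.insert k).erase l) (by simp)
  simp only [normalOrdL_apply, normalOrd, contract, wedgeMul, Pi.sub_apply]
  split_ifs <;> simp [h1, h2]

theorem bilinear_one_apply (n : ℤ) (β : Formal) (S : Maya) :
    bilinear n 1 β S = ∑ᶠ l : ℤ, normalOrd l (l + n) β S := by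
  change ∑ᶠ l : ℤ, (1 : Polynomial ℂ).eval (l : ℂ) * normalOrd l (l + n) β S = _
  simp

theorem normalOrd_support (n : ℤ) (β : Formal) (S : Maya) :
    (Function.support fun l => normalOrd l (l + n) β S).Finite :=
  (normalOrd_support_finite n S).subset fun _ hl => ⟨β, hl⟩

/-- At a given basis state only finitely many summands can be nonzero, uniformly in the bra, and
each of them reads finitely many coefficients. -/
theorem rowFinite_bilinear_one (n : ℤ) : RowFinite (bilinear n 1) := by
  classical
  intro S
  choose F hF using fun l => rowFinite_normalOrdL l (l + n) S
  refine ⟨(normalOrd_support_finite n S).toFinset.biUnion F, fun β h => ?_⟩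
  rw [bilinear_one_apply]
  refine finsum_eq_zero_of_forall_eq_zero fun l => ?_
  by_contra hl
  refine hl (hF l β fun T hT => h T ?_)
  exact Finset.mem_biUnion.mpr ⟨l, (Set.Finite.mem_toFinset _).mpr ⟨β, hl⟩, hT⟩

/-! ### The Heisenberg algebra -/

/-- Commuting with the whole current picks out two summands by the anticommutation relations. The
scalar is the mismatch between the vacuum subtractions of the two resulting bilinears; it is the
source of the Schwinger term. -/
theorem bilinear_normalOrd_commutator (n l k : ℤ) (β : Formal) (S : Maya) :
    bilinear n 1 (normalOrd l k β) S - normalOrd l k (bilinear n 1 β) S =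
      normalOrd l (k + n) β S - normalOrd (l - n) k β S +
        (if l = k + n then ((if l < 0 then 1 else 0) - if k < 0 then 1 else 0) else 0) * β S := by
  have h1 := (rowFinite_normalOrdL l k).apply_finsum (normalOrd_support n β) S
  have h2 : (fun T => ∑ᶠ i, normalOrd i (i + n) β T) = bilinear n 1 β :=
    funext fun T => (bilinear_one_apply n β T).symm
  rw [h2] at h1
  simp only [normalOrdL_apply] at h1
  rw [h1.2, bilinear_one_apply, ← finsum_sub_distrib (normalOrd_support n _ S) h1.1]
  have h3 : ∀ l', normalOrd l' (l' + n) (normalOrd l k β) S -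
      normalOrd l k (normalOrd l' (l' + n) β) S =
      (if l' = k then contract (k + n) (wedgeMul l β) S else 0) -
        if l' = l - n then contract k (wedgeMul (l - n) β) S else 0 := by
    intro l'
    have h := congrFun (LinearMap.congr_fun (normalOrdL_commutator l' (l' + n) l k) β) S
    have e : l' + n = l ↔ l' = l - n := by omega
    simp only [e] at h
    refine h.trans ?_
    rw [LinearMap.sub_apply, Pi.sub_apply]
    congr 1
    · split_ifs with h
      · subst h; rfl
      · rfl
    · split_ifs with h
      · subst h; rfl
      · rfl
  rw [finsum_congr h3, finsum_sub_distrib, finsum_eq_single _ k (by simp +contextual),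
    finsum_eq_single _ (l - n) (by simp +contextual), if_pos rfl, if_pos rfl]
  · simp only [normalOrd, Pi.sub_apply]
    have e1 : l - n = k ↔ l = k + n := by omega
    simp only [e1]
    by_cases h : l = k + n
    · simp only [h, true_and, if_true]
      split_ifs <;> simp <;> ring
    · simp [h]
  · exact (Set.finite_singleton k).subset fun x hx => by
      by_contra h
      exact hx (if_neg h)
  · exact (Set.finite_singleton (l - n)).subset fun x hx => by
      by_contra h
      exact hx (if_neg h)

/-- The summand is ±1 on the |m| integers l for which l and l + m lie on different sides of the
Fermi level, and 0 elsewhere. The sign is that of m. -/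
theorem finsum_sign_change (m : ℤ) :
    (Function.support fun l : ℤ =>
      (((if l < 0 then 1 else 0) - if l + m < 0 then 1 else 0 : ℂ))).Finite ∧
    ∑ᶠ l : ℤ, (((if l < 0 then 1 else 0) - if l + m < 0 then 1 else 0 : ℂ)) = m := by
  rcases le_total 0 m with h | h
  · have hs : (Function.support fun l : ℤ =>
        (((if l < 0 then 1 else 0) - if l + m < 0 then 1 else 0 : ℂ))) ⊆ Finset.Ico (-m) 0 := by
      intro l hl
      by_contra hc
      apply hl
      beta_reduce
      simp only [Finset.coe_Ico, Set.mem_Ico, not_and, not_lt] at hc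
      split_ifs <;> first | omega | simp
    refine ⟨(Finset.finite_toSet _).subset hs, ?_⟩
    rw [finsum_eq_sum_of_support_subset _ hs, Finset.sum_congr rfl (g := fun _ => (1 : ℂ))]
    · simp only [Finset.sum_const, Int.card_Ico, nsmul_eq_mul, mul_one]
      rw [show (0 - -m) = m by ring]
      exact_mod_cast congrArg (Int.cast : ℤ → ℂ) (Int.toNat_of_nonneg h)
    · intro l hl
      rw [Finset.mem_Ico] at hl
      rw [if_pos (by omega), if_neg (by omega), sub_zero]
  · have hs : (Function.support fun l : ℤ =>
        (((if l < 0 then 1 else 0) - if l + m < 0 then 1 else 0 : ℂ))) ⊆ Finset.Ico 0 (-m) := by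
      intro l hl
      by_contra hc
      apply hl
      beta_reduce
      simp only [Finset.coe_Ico, Set.mem_Ico, not_and, not_lt] at hc
      split_ifs <;> first | omega | simp
    refine ⟨(Finset.finite_toSet _).subset hs, ?_⟩
    rw [finsum_eq_sum_of_support_subset _ hs, Finset.sum_congr rfl (g := fun _ => (-1 : ℂ))]
    · simp only [Finset.sum_const, Int.card_Ico, nsmul_eq_mul, mul_neg, mul_one, sub_zero]
      have := congrArg (Int.cast : ℤ → ℂ) (Int.toNat_of_nonneg (a := -m) (by omega))
      push_cast at this
      rw [this]; ring
    · intro l hl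
      rw [Finset.mem_Ico] at hl
      rw [if_neg (by omega), if_pos (by omega), zero_sub]

/-- The Heisenberg algebra `[α_m, α_n] = m δ_{m+n,0}`, acting from the right. -/
theorem bilinear_one_commutator (n m : ℤ) :
    bilinear n 1 * bilinear m 1 - bilinear m 1 * bilinear n 1 =
      (if m + n = 0 then (m : ℂ) else 0) • (1 : Module.End ℂ Formal) := by
  refine LinearMap.ext fun β => funext fun S => ?_
  change bilinear n 1 (bilinear m 1 β) S - bilinear m 1 (bilinear n 1 β) S = _ * β S
  have h1 := (rowFinite_bilinear_one n).apply_finsum (normalOrd_support m β) S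
  have h2 : (fun T => ∑ᶠ i, normalOrd i (i + m) β T) = bilinear m 1 β :=
    funext fun T => (bilinear_one_apply m β T).symm
  rw [h2] at h1
  rw [h1.2, bilinear_one_apply m, ← finsum_sub_distrib h1.1 (normalOrd_support m _ S)]
  have e : ∀ l, (l = l + m + n) ↔ m + n = 0 := fun l => by omega
  simp only [bilinear_normalOrd_commutator, e]
  have f1 : (Function.support fun l => normalOrd l (l + m + n) β S).Finite := by
    simpa only [add_assoc] using normalOrd_support (m + n) β S
  -- The two bilinear sums differ by the shift l ↦ l - n. Each is finite at S, so they cancel and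
  -- only the anomaly survives.
  have e2 : (fun l => normalOrd (l - n) (l + m) β S) =
      (fun l => normalOrd l (l + m + n) β S) ∘ Equiv.subRight n := by
    funext l
    simp only [Function.comp_apply, Equiv.subRight_apply]
    congr 1
    ring
  have f2 : (Function.support fun l => normalOrd (l - n) (l + m) β S).Finite := by
    rw [e2]
    exact f1.preimage (Equiv.injective _).injOn
  have s2 : ∑ᶠ l, normalOrd (l - n) (l + m) β S = ∑ᶠ l, normalOrd l (l + m + n) β S := by
    rw [e2]
    exact finsum_comp_equiv (Equiv.subRight n) (f := fun l => normalOrd l (l + m + n) β S)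
  by_cases h : m + n = 0
  · simp only [h, if_true]
    obtain ⟨g1, g2⟩ := finsum_sign_change m
    rw [finsum_add_distrib, finsum_sub_distrib f1 f2, s2, sub_self, zero_add, ← finsum_mul, g2]
    · exact (f1.union f2).subset (Function.support_sub _ _)
    · exact g1.subset fun l hl => left_ne_zero_of_mul hl
  · simp only [h, if_false, zero_mul, add_zero]
    rw [finsum_sub_distrib f1 f2, s2, sub_self]

/-! ### The level of a basis state -/

namespace Maya

/-- The contribution of the label `x` to the level. -/
def weight (S : Maya) (x : ℤ) : ℤ :=
  open Classical in if x < 0 then (if x ∈ S.carrier then -x else 0) else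
    if x ∈ S.carrier then 0 else x

theorem weight_nonneg (S : Maya) (x : ℤ) : 0 ≤ S.weight x := by
  unfold weight
  split_ifs <;> omega

theorem weight_support (S : Maya) : (Function.support S.weight).Finite := by
  refine (S.finite_holes.union S.finite_particles).subset fun x hx => ?_
  by_contra h
  apply hx
  simp only [Set.mem_union, Set.mem_ofPred_eq, not_or, not_and, not_not] at h
  unfold weight
  split_ifs with h1 h2 h2
  · exact absurd h2 (h.2 h1)
  · rfl
  · rfl
  · exact absurd (h.1 (not_lt.mp h1)) h2

/-- The level of a basis state above the Dirac vacuum, up to a function of the charge. -/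
def level (S : Maya) : ℤ := ∑ᶠ x, S.weight x

theorem level_nonneg (S : Maya) : 0 ≤ S.level := finsum_nonneg S.weight_nonneg

/-- The weight at x exceeds its value for an occupied x by x when x becomes empty, whichever side of
the Fermi level x lies on; thus filling k costs k and emptying l gains l. -/
theorem level_move {S : Maya} {l k : ℤ} (hl : l ∈ S.carrier) (hk : k ∉ S.carrier) :
    ((S.insert k).erase l).level = S.level - k + l := by
  have hlk : l ≠ k := fun h => hk (h ▸ hl)
  have e : ∀ x, ((S.insert k).erase l).weight x =
      S.weight x - (if x = k then k else 0) + if x = l then l else 0 := by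
    intro x
    have hm : x ∈ ((S.insert k).erase l).carrier ↔ (x ∈ S.carrier ∨ x = k) ∧ x ≠ l := Iff.rfl
    unfold weight
    rcases eq_or_ne x l with rfl | h1
    · have hm' : x ∉ ((S.insert k).erase x).carrier := fun h => (hm.mp h).2 rfl
      simp only [hm', hl, hlk, if_false, if_true]
      split_ifs <;> omega
    · rcases eq_or_ne x k with rfl | h2
      · have hm' : x ∈ ((S.insert x).erase l).carrier := hm.mpr ⟨Or.inr rfl, h1⟩
        simp only [hm', hk, h1, if_false, if_true]
        split_ifs <;> omega
      · have hm' : x ∈ ((S.insert k).erase l).carrier ↔ x ∈ S.carrier := by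
          rw [hm]; simp [h1, h2]
        simp only [h1, h2, if_false, sub_zero, add_zero]
        by_cases hx : x ∈ S.carrier
        · simp only [hx, hm'.mpr hx]
        · simp only [hx, mt hm'.mp hx]
  have f : ∀ y : ℤ, (Function.support fun x : ℤ => if x = y then y else 0).Finite := fun y =>
    (Set.finite_singleton y).subset fun x hx => by
      by_contra h
      exact hx (if_neg h)
  have s : ∀ y : ℤ, ∑ᶠ x : ℤ, (if x = y then y else 0) = y := fun y => by
    rw [finsum_eq_single _ y (by simp +contextual), if_pos rfl]
  unfold level
  rw [finsum_congr e, finsum_add_distrib _ (f l), finsum_sub_distrib S.weight_support (f k), s, s]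
  exact (S.weight_support.union (f k)).subset (Function.support_sub _ _)

end Maya

/-- A bilinear which is off-diagonal moves one label. -/
theorem normalOrd_ne_zero {l k : ℤ} (h : l ≠ k) {β : Formal} {S : Maya}
    (hne : normalOrd l k β S ≠ 0) :
    l ∈ S.carrier ∧ k ∉ S.carrier ∧ β ((S.insert k).erase l) ≠ 0 := by
  rw [normalOrd, if_neg fun h' => h h'.1, sub_zero] at hne
  have hk : k ∉ S.carrier := fun hk => hne (contract_of_mem hk _)
  rw [contract_of_notMem hk] at hne
  have hl : l ∈ (S.insert k).carrier := by_contra fun hl => hne (by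
    rw [wedgeMul_of_notMem hl, mul_zero])
  rw [wedgeMul_of_mem hl] at hne
  exact ⟨(Maya.mem_insert.mp hl).resolve_right h, hk,
    right_ne_zero_of_mul (right_ne_zero_of_mul hne)⟩

theorem bilinear_one_eq_zero_of_level {n : ℤ} (hn : 1 ≤ n) {β : Formal} {c : ℤ}
    (h : ∀ T : Maya, T.level < c → β T = 0) (S : Maya) (hS : S.level < c + 1) :
    bilinear n 1 β S = 0 := by
  rw [bilinear_one_apply]
  refine finsum_eq_zero_of_forall_eq_zero fun l => ?_
  by_contra hne
  obtain ⟨h1, h2, h3⟩ := normalOrd_ne_zero (by omega) hne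
  refine h3 (h _ ?_)
  rw [Maya.level_move h1 h2]
  omega

theorem background_apply (p q : ℕ) (g : ℂ) (b : ℕ → ℂ) (β : Formal) (S : Maya) :
    background p q g b β S =
      g⁻¹ * ∑ n ∈ Finset.Icc 1 (p + q), b n * bilinear (n : ℤ) 1 β S := by
  simp [background, Finset.sum_apply]

/-- Levels are nonnegative and each α_n with n ≥ 1 raises the level of a bra by n, so k factors
leave nothing below level k. This makes the exponential series finite at each basis state. -/
theorem background_pow_eq_zero (p q : ℕ) (g : ℂ) (b : ℕ → ℂ) (β : Formal) (k : ℕ) :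
    ∀ S : Maya, S.level < k → (background p q g b ^ k) β S = 0 := by
  induction k with
  | zero => exact fun S hS => absurd S.level_nonneg (by simpa using hS)
  | succ k ih =>
    intro S hS
    rw [pow_succ', Module.End.mul_apply, background_apply]
    refine mul_eq_zero_of_right _ (Finset.sum_eq_zero fun n hn => mul_eq_zero_of_right _ ?_)
    refine bilinear_one_eq_zero_of_level ?_ ih S (by simpa using hS)
    exact_mod_cast (Finset.mem_Icc.mp hn).1

/-! ### The coherent bra -/

/-- For n > 0 the move would have to end in the Dirac sea with l < 0 empty and l - n ≥ 0 filled,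
which is impossible. For n = 0 the diagonal terms cancel against the normal-ordering subtraction. -/
theorem bilinear_vacuum (n : ℕ) : bilinear (-(n : ℤ)) 1 (basisVec (Maya.sea 0)) = 0 := by
  have hb : ∀ T, basisVec (Maya.sea 0) T ≠ 0 → T = Maya.sea 0 := fun T hT => by
    by_contra h
    exact hT (if_neg h)
  funext S
  rw [bilinear_one_apply]
  refine finsum_eq_zero_of_forall_eq_zero fun l => ?_
  rcases Nat.eq_zero_or_pos n with rfl | hn
  · simp only [Nat.cast_zero, neg_zero, add_zero]
    change contract l (wedgeMul l _) S - (if l = l ∧ l < 0 then _ else (0 : Formal)) S = 0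
    simp only [true_and]
    by_cases hS : S = Maya.sea 0
    · subst hS
      by_cases hl : l < 0
      · have hl' : l ∉ (Maya.sea 0).carrier := fun h => absurd hl (not_lt.mpr h)
        rw [contract_of_notMem hl', wedgeMul_of_mem (Maya.mem_insert.mpr (Or.inr rfl)),
          Maya.erase_insert hl', Maya.sgn_insert hl', if_neg (lt_irrefl l), ← mul_assoc,
          Maya.sgn_mul_self, one_mul, if_pos hl, sub_self]
      · rw [contract_of_mem (not_lt.mp hl : (0 : ℤ) ≤ l), if_neg hl]
        simp
    · have h0 : basisVec (Maya.sea 0) S = 0 := if_neg hS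
      have h1 : (if l < 0 then basisVec (Maya.sea 0) else 0) S = 0 := by
        split_ifs
        · exact h0
        · rfl
      rw [h1, sub_zero]
      by_cases hl : l ∈ S.carrier
      · rw [contract_of_mem hl]
      · rw [contract_of_notMem hl, wedgeMul_of_mem (Maya.mem_insert.mpr (Or.inr rfl)),
          Maya.erase_insert hl, h0, mul_zero, mul_zero]
  · by_contra hne
    obtain ⟨h1, h2, h3⟩ := normalOrd_ne_zero (by omega) hne
    have h := congrArg Maya.carrier (hb _ h3)
    have h4 : l ∉ (Maya.sea 0).carrier := h ▸ fun h5 => (Maya.mem_erase.mp h5).2 rfl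
    have h5 : l + -(n : ℤ) ∈ (Maya.sea 0).carrier :=
      h ▸ Maya.mem_erase.mpr ⟨Maya.mem_insert.mpr (Or.inr rfl), by omega⟩
    have h6 : ¬ (0 : ℤ) ≤ l := h4
    have h7 : (0 : ℤ) ≤ l + -(n : ℤ) := h5
    omega

theorem mul_pow_of_commutator {V : Type*} [AddCommGroup V] [Module ℂ V] {A B : Module.End ℂ V}
    {c : ℂ} (h : A * B - B * A = c • 1) (k : ℕ) :
    A * B ^ (k + 1) = B ^ (k + 1) * A + ((k + 1 : ℂ) * c) • B ^ k := by
  have h' : A * B = B * A + c • 1 := by rw [← h]; abel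
  induction k with
  | zero => simpa using h'
  | succ k ih =>
    rw [pow_succ B (k + 1), ← mul_assoc, ih, add_mul, mul_assoc, h', mul_add, ← mul_assoc,
      smul_mul_assoc, mul_smul_comm, mul_one, ← pow_succ, ← pow_succ]
    push_cast
    module

theorem commutator_smul_sum {V ι : Type*} [AddCommGroup V] [Module ℂ V] (A : Module.End ℂ V)
    (r : ℂ) (s : Finset ι) (c : ι → ℂ) (X : ι → Module.End ℂ V) :
    A * (r • ∑ i ∈ s, c i • X i) - (r • ∑ i ∈ s, c i • X i) * A =
      r • ∑ i ∈ s, c i • (A * X i - X i * A) := by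
  rw [mul_smul_comm, smul_mul_assoc, ← smul_sub, Finset.mul_sum, Finset.sum_mul,
    ← Finset.sum_sub_distrib]
  simp only [mul_smul_comm, smul_mul_assoc, smul_sub]

/-- The eigenvalue of `α_{-n}` on the bra `⟨b/g|`. -/
def coherentEigenvalue (p q : ℕ) (g : ℂ) (b : ℕ → ℂ) (n : ℕ) : ℂ :=
  g⁻¹ * if n ∈ Finset.Icc 1 (p + q) then (n : ℂ) * b n else 0

/-- Only the oscillator with m = n in the background is conjugate to α_{-n}. The case n = 0 is
included, with scalar 0. -/
theorem bilinear_background_commutator (p q : ℕ) (g : ℂ) (b : ℕ → ℂ) (n : ℕ) :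
    bilinear (-(n : ℤ)) 1 * background p q g b - background p q g b * bilinear (-(n : ℤ)) 1 =
      coherentEigenvalue p q g b n • 1 := by
  unfold background coherentEigenvalue
  rw [commutator_smul_sum, mul_smul]
  congr 1
  have h : ∀ m ∈ Finset.Icc 1 (p + q),
      b m • (bilinear (-(n : ℤ)) 1 * bilinear (m : ℤ) 1 -
        bilinear (m : ℤ) 1 * bilinear (-(n : ℤ)) 1) =
      if n = m then ((n : ℂ) * b n) • (1 : Module.End ℂ Formal) else 0 := by
    intro m _
    rw [bilinear_one_commutator]
    by_cases hm : n = m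
    · subst hm
      rw [if_pos (by omega), if_pos rfl, smul_smul, mul_comm]
      norm_cast
    · rw [if_neg (by omega), if_neg hm, zero_smul, smul_zero]
  rw [Finset.sum_congr rfl h, Finset.sum_ite_eq]
  split_ifs <;> simp

theorem expBra_pointwise (p q : ℕ) (g : ℂ) (b : ℕ → ℂ) (β : Formal) (S : Maya) :
    (Function.support fun k : ℕ =>
      (((k ! : ℂ))⁻¹ • (background p q g b ^ k) β) S) ⊆ Finset.range (S.level.toNat + 1) := by
  intro k hk
  by_contra h
  apply hk
  simp only [Finset.coe_range, Set.mem_Iio, not_lt] at h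
  beta_reduce
  rw [Pi.smul_apply, background_pow_eq_zero p q g b β k S (by omega), smul_zero]

/-- The standard coherent-state argument: commuting α_{-n} through B^(k+1)/(k+1)! yields c B^k/k!
plus a term annihilated on the vacuum, so the exponential series is reproduced with an index shift.
Row-finiteness permits applying α_{-n} term by term. -/
theorem bilinear_expBra (p q : ℕ) (g : ℂ) (b : ℕ → ℂ) (n : ℕ) :
    bilinear (-(n : ℤ)) 1 (expBra p q g b (Maya.sea 0)) =
      coherentEigenvalue p q g b n • expBra p q g b (Maya.sea 0) := by
  set v := basisVec (Maya.sea 0)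
  set B := background p q g b
  set c := coherentEigenvalue p q g b n
  funext S
  have h := (rowFinite_bilinear_one (-(n : ℤ))).apply_finsum
    (β := fun k : ℕ => ((k ! : ℂ))⁻¹ • (B ^ k) v)
    (fun T => (Finset.finite_toSet _).subset (expBra_pointwise p q g b v T)) S
  have e : ∀ k : ℕ, bilinear (-(n : ℤ)) 1 ((((k + 1) ! : ℕ) : ℂ)⁻¹ • (B ^ (k + 1)) v) =
      c • ((k ! : ℂ))⁻¹ • (B ^ k) v := by
    intro k
    have h1 := LinearMap.congr_fun
      (mul_pow_of_commutator (bilinear_background_commutator p q g b n) k) v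
    rw [Module.End.mul_apply, LinearMap.add_apply, Module.End.mul_apply, bilinear_vacuum, map_zero,
      zero_add, LinearMap.smul_apply] at h1
    rw [map_smul, h1, smul_smul, smul_smul]
    congr 1
    have h2 : (k ! : ℂ) ≠ 0 := by exact_mod_cast k.factorial_ne_zero
    have h3 : (k + 1 : ℂ) ≠ 0 := by exact_mod_cast k.succ_ne_zero
    rw [Nat.factorial_succ]
    push_cast
    field_simp
    rfl
  have e0 : bilinear (-(n : ℤ)) 1 (((0 ! : ℕ) : ℂ)⁻¹ • (B ^ 0) v) = 0 := by
    rw [map_smul, pow_zero, Module.End.one_apply, bilinear_vacuum, smul_zero]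
  have h' : bilinear (-(n : ℤ)) 1 (expBra p q g b (Maya.sea 0)) S = _ := h.2
  have hs := expBra_pointwise p q g b v S
  -- The range is one longer than in `hs`, because α_{-n} lowers the power of B by one.
  have hs' : (Function.support fun k : ℕ =>
      bilinear (-(n : ℤ)) 1 (((k ! : ℂ))⁻¹ • (B ^ k) v) S) ⊆
        Finset.range (S.level.toNat + 1 + 1) := by
    intro k hk
    rcases k with _ | k
    · simp
    · rw [Function.mem_support, e, Pi.smul_apply] at hk
      have := hs (right_ne_zero_of_mul hk : (((k ! : ℂ))⁻¹ • (B ^ k) v) S ≠ 0)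
      simp only [Finset.coe_range, Set.mem_Iio] at this ⊢
      omega
  rw [h', finsum_eq_sum_of_support_subset _ hs', Finset.sum_range_succ', e0, Pi.zero_apply,
    add_zero, Pi.smul_apply, smul_eq_mul]
  change _ = c * ∑ᶠ k : ℕ, (((k ! : ℂ))⁻¹ • (B ^ k) v) S
  rw [finsum_eq_sum_of_support_subset _ hs, Finset.mul_sum]
  refine Finset.sum_congr rfl fun k _ => ?_
  rw [e]
  rfl

/-! ### Oscillators on the space of bras -/

theorem alpha_commutator (p q : ℕ) (g : ℂ) (b : ℕ → ℂ) (n m : ℤ) :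
    alpha p q g b n * alpha p q g b m - alpha p q g b m * alpha p q g b n =
      (if m + n = 0 then (m : ℂ) else 0) • (1 : Module.End ℂ (braSpace p q g b)) :=
  LinearMap.ext fun β => Subtype.ext (LinearMap.congr_fun (bilinear_one_commutator n m) (β : Formal))

theorem alpha_neg_bgBra (p q : ℕ) (g : ℂ) (b : ℕ → ℂ) (n : ℕ) :
    alpha p q g b (-(n : ℤ)) (bgBra p q g b) = coherentEigenvalue p q g b n • bgBra p q g b :=
  Subtype.ext (bilinear_expBra p q g b n)

/-! ### Contour integrals of Laurent polynomials -/

theorem circleMap_zero_ne_zero {R : ℝ} (hR : 0 < R) (θ : ℝ) : circleMap 0 R θ ≠ 0 :=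
  circleMap_ne_center hR.ne'

theorem ne_zero_of_mem_sphere {R : ℝ} (hR : 0 < R) {z : ℂ} (hz : z ∈ Metric.sphere (0 : ℂ) R) :
    z ≠ 0 := Metric.ne_of_mem_sphere hz hR.ne'

theorem circleIntegrable_zpow {R : ℝ} (hR : 0 < R) (k : ℤ) :
    CircleIntegrable (fun z : ℂ => z ^ k) 0 R :=
  ContinuousOn.circleIntegrable hR.le fun _ hz =>
    (continuousAt_zpow₀ _ _ (Or.inl (ne_zero_of_mem_sphere hR hz))).continuousWithinAt

theorem circleIntegral_zpow {R : ℝ} (hR : 0 < R) (k : ℤ) :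
    (2 * Real.pi * Complex.I)⁻¹ * (∮ z in C(0, R), z ^ k) = if k = -1 then 1 else 0 := by
  split_ifs with h
  · subst h
    have := circleIntegral.integral_sub_center_inv 0 hR.ne'
    simp only [sub_zero] at this
    simp only [zpow_neg_one, this]
    exact inv_mul_cancel₀ Complex.two_pi_I_ne_zero
  · have := circleIntegral.integral_sub_zpow_of_ne h 0 0 R
    simp only [sub_zero] at this
    rw [this, mul_zero]

theorem oint_congr {p : ℕ} {R : ℝ} (hR : 0 < R) {f h : ℂ → ℂ}
    (e : ∀ z ∈ Metric.sphere (0 : ℂ) R, (p : ℂ) * z ^ (p - 1) * f z = h z) :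
    oint p R f = (2 * Real.pi * Complex.I)⁻¹ * ∮ z in C(0, R), h z := by
  unfold oint
  rw [circleIntegral.integral_congr hR.le e]

theorem circleIntegral_laurent {ι : Type*} {R : ℝ} (hR : 0 < R) (s : Finset ι) (c : ι → ℂ)
    (k : ι → ℤ) :
    (2 * Real.pi * Complex.I)⁻¹ * (∮ z in C(0, R), ∑ i ∈ s, c i * z ^ k i) =
      ∑ i ∈ s, if k i = -1 then c i else 0 := by
  rw [circleIntegral.integral_fun_sum, Finset.mul_sum]
  · refine Finset.sum_congr rfl fun i _ => ?_
    rw [circleIntegral.integral_const_mul, mul_left_comm, circleIntegral_zpow hR]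
    split_ifs <;> simp
  · intro i _
    exact (circleIntegrable_zpow hR (k i)).const_smul (a := c i)

theorem source_eq (j : ℤ →₀ ℂ) (z : ℂ) : source j z = ∑ k ∈ j.support, j k * z ^ k := rfl

theorem sum_source_ite (j : ℤ →₀ ℂ) (a : ℂ) (n : ℤ) :
    (∑ k ∈ j.support, if k = n then j k * a else 0) = j n * a := by
  rw [Finset.sum_ite_eq']
  split_ifs with h
  · rfl
  · rw [Finsupp.notMem_support_iff.mp h, zero_mul]

theorem zpow_jacobian {p : ℕ} (hp : 0 < p) {z : ℂ} (hz : z ≠ 0) (m : ℤ) :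
    z ^ (p - 1) * z ^ (m - (p : ℤ)) = z ^ (m - 1) := by
  rw [← zpow_natCast, ← zpow_add₀ hz]
  congr 1
  push_cast [hp]
  ring

/-- The Jacobian dζ = p λ^(p-1) dλ cancels the prefactor 1/p and shifts exponents by p - 1, so the
residue selects the source mode opposite to each exponent. Both `sourceMode` and the disk integral
are instances. -/
theorem oint_source_mul_sum {ι : Type*} {p : ℕ} (hp : 0 < p) {R : ℝ} (hR : 0 < R) (j : ℤ →₀ ℂ)
    (s : Finset ι) (c : ι → ℂ) (m : ι → ℤ) :
    oint p R (fun z => source j z * ((p : ℂ)⁻¹ * ∑ i ∈ s, c i * z ^ (m i - (p : ℤ)))) =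
      ∑ i ∈ s, c i * j (-m i) := by
  have hp' : (p : ℂ) ≠ 0 := by exact_mod_cast hp.ne'
  rw [oint_congr hR (h := fun z => ∑ x ∈ s ×ˢ j.support, (c x.1 * j x.2) * z ^ (x.2 + m x.1 - 1))]
  · rw [circleIntegral_laurent hR, Finset.sum_product]
    refine Finset.sum_congr rfl fun i _ => ?_
    rw [mul_comm, ← sum_source_ite]
    refine Finset.sum_congr rfl fun k _ => ?_
    simp only [show k + m i - 1 = -1 ↔ k = -m i by omega, mul_comm]
  · intro z hz
    have hz0 := ne_zero_of_mem_sphere hR hz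
    rw [source_eq, Finset.sum_product, Finset.mul_sum, Finset.mul_sum, Finset.mul_sum]
    refine Finset.sum_congr rfl fun i _ => ?_
    rw [Finset.sum_mul, Finset.mul_sum]
    refine Finset.sum_congr rfl fun k _ => ?_
    rw [add_sub_assoc, zpow_add₀ hz0, ← zpow_jacobian hp hz0]
    field_simp

theorem sourceMode_eq {p : ℕ} (hp : 0 < p) {R : ℝ} (hR : 0 < R) (j : ℤ →₀ ℂ) (n : ℤ) :
    sourceMode p R j n = j n := by
  have h := oint_source_mul_sum hp hR j {()} (fun _ => 1) (fun _ => -n)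
  simpa [sourceMode] using h

theorem oint_N₁ {p : ℕ} (hp : 0 < p) (q : ℕ) (b : ℕ → ℂ) {R : ℝ} (hR : 0 < R) (j : ℤ →₀ ℂ) :
    oint p R (fun z => source j z * N₁ p q b z) =
      ∑ n ∈ Finset.Icc 1 (p + q), (n : ℂ) * b n * j (-(n : ℤ)) :=
  oint_source_mul_sum hp hR j _ _ _

/-! ### The annulus integral -/

theorem continuous_source_circleMap (j : ℤ →₀ ℂ) {R : ℝ} (hR : 0 < R) :
    Continuous fun θ => source j (circleMap 0 R θ) := by
  simp only [source_eq]
  refine continuous_finsetSum _ fun k _ => continuous_const.mul ?_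
  exact (continuous_circleMap 0 R).zpow₀ k fun θ => Or.inl (circleMap_zero_ne_zero hR θ)

/-- Continuity of the kernels on the torus gives integrability of the inner integrand and, as a
continuous parametric integral, of the outer one. -/
theorem oint₂_sub (p : ℕ) {R₁ R₂ : ℝ} (h₁ : 0 < R₁) (h₂ : 0 < R₂) (j : ℤ →₀ ℂ) {K L : ℂ → ℂ → ℂ}
    (hK : Continuous fun x : ℝ × ℝ => K (circleMap 0 R₁ x.1) (circleMap 0 R₂ x.2))
    (hL : Continuous fun x : ℝ × ℝ => L (circleMap 0 R₁ x.1) (circleMap 0 R₂ x.2)) :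
    oint₂ p R₁ R₂ j (fun z w => K z w - L z w) = oint₂ p R₁ R₂ j K - oint₂ p R₁ R₂ j L := by
  have hint : ∀ {M : ℂ → ℂ → ℂ},
      Continuous (fun x : ℝ × ℝ => M (circleMap 0 R₁ x.1) (circleMap 0 R₂ x.2)) →
      Continuous (fun x : ℝ × ℝ => (p : ℂ) * circleMap 0 R₂ x.2 ^ (p - 1) *
        (source j (circleMap 0 R₁ x.1) * source j (circleMap 0 R₂ x.2) *
          M (circleMap 0 R₁ x.1) (circleMap 0 R₂ x.2))) := by
    intro M hM
    have c1 := (continuous_source_circleMap j h₁).comp (continuous_fst (X := ℝ) (Y := ℝ))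
    have c2 := (continuous_source_circleMap j h₂).comp (continuous_snd (X := ℝ) (Y := ℝ))
    have c3 := (continuous_circleMap 0 R₂).comp (continuous_snd (X := ℝ) (Y := ℝ))
    exact (continuous_const.mul (c3.pow _)).mul ((c1.mul c2).mul hM)
  have hin : ∀ {M : ℂ → ℂ → ℂ},
      Continuous (fun x : ℝ × ℝ => M (circleMap 0 R₁ x.1) (circleMap 0 R₂ x.2)) →
      ∀ z ∈ Metric.sphere (0 : ℂ) R₁, CircleIntegrable
        (fun w => (p : ℂ) * w ^ (p - 1) * (source j z * source j w * M z w)) 0 R₂ := by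
    intro M hM z hz
    rw [← abs_of_pos h₁, ← range_circleMap] at hz
    obtain ⟨θ, rfl⟩ := hz
    exact ((hint hM).comp (Continuous.prodMk_right θ)).intervalIntegrable _ _
  have hout : ∀ {M : ℂ → ℂ → ℂ},
      Continuous (fun x : ℝ × ℝ => M (circleMap 0 R₁ x.1) (circleMap 0 R₂ x.2)) →
      CircleIntegrable (fun z => (p : ℂ) * z ^ (p - 1) *
        oint p R₂ fun w => source j z * source j w * M z w) 0 R₁ := by
    intro M hM
    have c1 : Continuous fun θ => (p : ℂ) * circleMap 0 R₁ θ ^ (p - 1) :=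
      continuous_const.mul ((continuous_circleMap 0 R₁).pow _)
    refine Continuous.intervalIntegrable (c1.mul (continuous_const.mul ?_)) _ _
    refine intervalIntegral.continuous_parametric_intervalIntegral_of_continuous' ?_ _ _
    have c2 : Continuous fun x : ℝ × ℝ => deriv (circleMap 0 R₂) x.2 := by
      simp only [deriv_circleMap]
      exact ((continuous_circleMap 0 R₂).comp continuous_snd).mul continuous_const
    exact c2.smul (hint hM)
  have e : ∀ f : ℂ → ℂ, oint p R₁ f =
      (2 * Real.pi * Complex.I)⁻¹ * ∮ z in C(0, R₁), (p : ℂ) * z ^ (p - 1) * f z := fun _ => rfl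
  rw [oint₂, oint₂, oint₂, e, e, e, ← mul_sub, ← circleIntegral.integral_sub (hout hK) (hout hL)]
  congr 1
  refine circleIntegral.integral_congr h₁.le fun z hz => ?_
  rw [← mul_sub]
  congr 1
  unfold oint
  rw [← mul_sub, ← circleIntegral.integral_sub (hin hK z hz) (hin hL z hz)]
  congr 1
  refine circleIntegral.integral_congr h₂.le fun w _ => ?_
  ring

theorem circleIntegral_pow_div_sq {R : ℝ} (hR : 0 < R) {z : ℂ} (hz : R < ‖z‖) (k : ℕ) :
    (∮ w in C(0, R), w ^ k / (z - w) ^ 2) = 0 := by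
  have hne : ∀ w ∈ Metric.closedBall (0 : ℂ) R, (z - w) ^ 2 ≠ 0 := fun w hw => by
    refine pow_ne_zero 2 (sub_ne_zero.mpr ?_)
    rintro rfl
    exact absurd hz (not_lt.mpr (mem_closedBall_zero_iff.mp hw))
  have hd : DifferentiableOn ℂ (fun w : ℂ => w ^ k / (z - w) ^ 2) (Metric.closedBall 0 R) :=
    DifferentiableOn.div (by fun_prop) (by fun_prop) hne
  refine Complex.circleIntegral_eq_zero_of_differentiable_on_off_countable hR.le
    Set.countable_empty hd.continuousOn fun w hw => ?_
  exact hd.differentiableAt (Metric.closedBall_mem_nhds_of_mem hw.1)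

theorem circleIntegrable_zpow_div_sq {R : ℝ} (hR : 0 < R) {z : ℂ} (hz : R < ‖z‖) (k : ℤ) :
    CircleIntegrable (fun w => w ^ k / (z - w) ^ 2) 0 R := by
  refine ContinuousOn.circleIntegrable hR.le fun w hw => ?_
  have h1 : (z - w) ^ 2 ≠ 0 := by
    refine pow_ne_zero 2 (sub_ne_zero.mpr ?_)
    rintro rfl
    exact absurd (mem_sphere_zero_iff_norm.mp hw) hz.ne'
  refine ContinuousAt.continuousWithinAt (ContinuousAt.div ?_ (by fun_prop) h1)
  exact continuousAt_zpow₀ _ _ (Or.inl (ne_zero_of_mem_sphere hR hw))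

/-- Instead of expanding the double pole in a series, one uses a three-term recursion in the
exponent, run downwards from the nonnegative exponents, where the integrand is holomorphic in the
disk. -/
theorem circleIntegral_zpow_neg_div_sq {R : ℝ} (hR : 0 < R) {z : ℂ} (hz : R < ‖z‖) (m : ℕ) :
    (2 * Real.pi * Complex.I)⁻¹ * (∮ w in C(0, R), w ^ (-(m : ℤ)) / (z - w) ^ 2) =
      m * z ^ (-(m : ℤ) - 1) := by
  have hz0 : z ≠ 0 := norm_pos_iff.mp (hR.trans hz)
  set a : ℤ → ℂ := fun k =>
    (2 * Real.pi * Complex.I)⁻¹ * (∮ w in C(0, R), w ^ k / (z - w) ^ 2) with ha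
  -- This is the integral of w^k, with the factor (z - w)²/(z - w)² expanded in the numerator.
  have hrec : ∀ k : ℤ, z ^ 2 * a k - 2 * z * a (k + 1) + a (k + 2) =
      if k = -1 then 1 else 0 := by
    intro k
    rw [← circleIntegral_zpow hR k]
    have i0 := circleIntegrable_zpow_div_sq hR hz k
    have i1 := circleIntegrable_zpow_div_sq hR hz (k + 1)
    have i2 := circleIntegrable_zpow_div_sq hR hz (k + 2)
    have j0 : CircleIntegrable (fun w => z ^ 2 * (w ^ k / (z - w) ^ 2)) 0 R :=
      i0.const_smul (a := z ^ 2)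
    have j1 : CircleIntegrable (fun w => 2 * z * (w ^ (k + 1) / (z - w) ^ 2)) 0 R :=
      i1.const_smul (a := 2 * z)
    have e : (∮ w in C(0, R), w ^ k) = ∮ w in C(0, R), (z ^ 2 * (w ^ k / (z - w) ^ 2) -
        2 * z * (w ^ (k + 1) / (z - w) ^ 2) + w ^ (k + 2) / (z - w) ^ 2) := by
      refine circleIntegral.integral_congr hR.le fun w hw => ?_
      have hw0 := ne_zero_of_mem_sphere hR hw
      have h1 : z - w ≠ 0 := by
        refine sub_ne_zero.mpr ?_
        rintro rfl
        exact absurd (mem_sphere_zero_iff_norm.mp hw) hz.ne'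
      simp only [zpow_add₀ hw0, zpow_ofNat]
      field_simp
      ring
    have j01 : CircleIntegrable (fun w => z ^ 2 * (w ^ k / (z - w) ^ 2) -
        2 * z * (w ^ (k + 1) / (z - w) ^ 2)) 0 R := j0.sub j1
    rw [e, circleIntegral.integral_add j01 i2, circleIntegral.integral_sub j0 j1,
      circleIntegral.integral_const_mul, circleIntegral.integral_const_mul]
    simp only [ha]
    ring
  have hpos : ∀ k : ℕ, a (k : ℤ) = 0 := fun k => by
    simp only [ha, zpow_natCast, circleIntegral_pow_div_sq hR hz k, mul_zero]
  -- The recursion has order two, so the induction carries two consecutive values. The inhomogeneous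
  -- term enters only in the base case, at exponent -1.
  suffices h : ∀ m : ℕ, a (-(m : ℤ)) = m * z ^ (-(m : ℤ) - 1) ∧
      a (-((m + 1 : ℕ) : ℤ)) = (m + 1 : ℕ) * z ^ (-((m + 1 : ℕ) : ℤ) - 1) from (h m).1
  intro m
  induction m with
  | zero =>
    refine ⟨by simpa using hpos 0, ?_⟩
    have h := hrec (-1)
    have h0 : a (-1 + 1) = 0 := hpos 0
    have h1 : a (-1 + 2) = 0 := hpos 1
    rw [h0, h1, if_pos rfl] at h
    have h2 : z ^ (-((0 + 1 : ℕ) : ℤ) - 1) = (z ^ 2)⁻¹ := by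
      rw [← zpow_natCast, ← zpow_neg]; rfl
    rw [h2]
    have h3 : (-((0 + 1 : ℕ) : ℤ)) = -1 := rfl
    rw [h3]
    field_simp
    push_cast
    linear_combination h
  | succ m ih =>
    refine ⟨ih.2, ?_⟩
    have h := hrec (-((m + 1 + 1 : ℕ) : ℤ))
    have e1 : (-((m + 1 + 1 : ℕ) : ℤ)) + 1 = -((m + 1 : ℕ) : ℤ) := by omega
    have e2 : (-((m + 1 + 1 : ℕ) : ℤ)) + 2 = -(m : ℤ) := by omega
    rw [e1, e2, ih.1, ih.2, if_neg (by omega)] at h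
    have e3 : z ^ (-((m + 1 : ℕ) : ℤ) - 1) = z ^ (-((m + 1 + 1 : ℕ) : ℤ) - 1) * z := by
      rw [← zpow_add_one₀ hz0]; congr 1
    have e4 : z ^ (-(m : ℤ) - 1) = z ^ (-((m + 1 + 1 : ℕ) : ℤ) - 1) * z * z := by
      rw [← zpow_add_one₀ hz0, ← zpow_add_one₀ hz0]; congr 1; omega
    rw [e3, e4] at h
    refine mul_left_cancel₀ (pow_ne_zero 2 hz0) ?_
    push_cast at h ⊢
    linear_combination h

/-- `∮ dλ₂/(2πi) λ₂^k / (λ₁ - λ₂)²` for `|λ₁| > |λ₂|`. -/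
theorem circleIntegral_zpow_div_sq {R : ℝ} (hR : 0 < R) {z : ℂ} (hz : R < ‖z‖) (k : ℤ) :
    (2 * Real.pi * Complex.I)⁻¹ * (∮ w in C(0, R), w ^ k / (z - w) ^ 2) =
      (if k < 0 then -(k : ℂ) else 0) * z ^ (k - 1) := by
  split_ifs with h
  · obtain ⟨m, rfl⟩ : ∃ m : ℕ, k = -(m : ℤ) := ⟨(-k).toNat, by omega⟩
    rw [circleIntegral_zpow_neg_div_sq hR hz]
    push_cast
    ring
  · obtain ⟨m, rfl⟩ : ∃ m : ℕ, k = (m : ℤ) := ⟨k.toNat, by omega⟩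
    simp only [zpow_natCast, circleIntegral_pow_div_sq hR hz, mul_zero, zero_mul]

/-- The self-contraction `∑_{n ≥ 1} n J_n J_{-n}` of the smeared boson in the `λ` plane. -/
def selfContraction (j : ℤ →₀ ℂ) : ℂ :=
  ∑ k ∈ j.support, (if k < 0 then -(k : ℂ) else 0) * j k * j (-k)

/-- The factors dλ/dζ cancel the Jacobians, leaving the double pole in the λ plane. The inner
integral turns each λ₂^k with k < 0 into -k λ₁^(k-1), and the outer residue pairs it with the mode
-k. -/
theorem oint₂_lambda {p : ℕ} (hp : 0 < p) {R₁ R₂ : ℝ} (h₂ : 0 < R₂) (hR : R₂ < R₁) (j : ℤ →₀ ℂ) :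
    oint₂ p R₁ R₂ j (fun z w => dRoot p z * dRoot p w / (z - w) ^ 2) = selfContraction j := by
  have h₁ := h₂.trans hR
  have hp' : (p : ℂ) ≠ 0 := by exact_mod_cast hp.ne'
  have hd : ∀ z : ℂ, z ≠ 0 → (p : ℂ) * z ^ (p - 1) * dRoot p z = 1 := by
    intro z hz
    have := zpow_jacobian hp hz 1
    rw [dRoot, mul_mul_mul_comm, mul_inv_cancel₀ hp', this]
    simp
  unfold oint₂
  rw [oint_congr h₁ (h := fun z => (p : ℂ) * z ^ (p - 1) * (source j z * ((p : ℂ)⁻¹ *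
    ∑ k ∈ j.support, ((if k < 0 then -(k : ℂ) else 0) * j k) * z ^ (k - (p : ℤ)))))]
  · have h := oint_source_mul_sum hp h₁ j j.support
      (fun k => (if k < 0 then -(k : ℂ) else 0) * j k) (fun k => k)
    unfold oint at h
    exact h
  · intro z hz
    have hz0 := ne_zero_of_mem_sphere h₁ hz
    congr 1
    rw [oint_congr h₂ (h := fun w => (source j z * dRoot p z) *
      ∑ k ∈ j.support, j k * (w ^ k / (z - w) ^ 2))]
    · have hz' : R₂ < ‖z‖ := by rw [mem_sphere_zero_iff_norm.mp hz]; exact hR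
      rw [circleIntegral.integral_const_mul, circleIntegral.integral_fun_sum, mul_left_comm,
        Finset.mul_sum, mul_assoc]
      · congr 1
        rw [dRoot, mul_assoc]
        congr 1
        rw [Finset.mul_sum]
        refine Finset.sum_congr rfl fun k _ => ?_
        rw [circleIntegral.integral_const_mul, mul_left_comm _ (j k),
          circleIntegral_zpow_div_sq h₂ hz', show k - (p : ℤ) = (1 - (p : ℤ)) + (k - 1) by ring,
          zpow_add₀ hz0]
        ring
      · intro k _
        exact (circleIntegrable_zpow_div_sq h₂ hz' k).const_smul (a := j k)
    · intro w hw
      have hw' := hd w (ne_zero_of_mem_sphere h₂ hw)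
      have e : ∑ k ∈ j.support, j k * (w ^ k / (z - w) ^ 2) = source j w / (z - w) ^ 2 := by
        rw [source_eq, Finset.sum_div]
        exact Finset.sum_congr rfl fun k _ => by ring
      simp only [e]
      calc _ = ((p : ℂ) * w ^ (p - 1) * dRoot p w) *
            (source j z * dRoot p z * (source j w / (z - w) ^ 2)) := by ring
        _ = _ := by rw [hw', one_mul]

/-- On separated circles both poles of N₂ are absent, so its two terms can be integrated separately.
The second integral is the contraction in the definition of `zetaExp` and is left as it stands. -/
theorem oint₂_N₂ {p : ℕ} (hp : 0 < p) {R₁ R₂ : ℝ} (h₂ : 0 < R₂) (hR : R₂ < R₁) (j : ℤ →₀ ℂ) :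
    oint₂ p R₁ R₂ j (N₂ p) =
      selfContraction j - oint₂ p R₁ R₂ j fun z w => 1 / (z ^ p - w ^ p) ^ 2 := by
  have h₁ := h₂.trans hR
  have c1 : Continuous fun x : ℝ × ℝ => circleMap 0 R₁ x.1 :=
    (continuous_circleMap 0 R₁).comp continuous_fst
  have c2 : Continuous fun x : ℝ × ℝ => circleMap 0 R₂ x.2 :=
    (continuous_circleMap 0 R₂).comp continuous_snd
  have n1 : ∀ θ, ‖circleMap 0 R₁ θ‖ = R₁ := fun θ => by
    rw [norm_circleMap_zero, abs_of_pos h₁]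
  have n2 : ∀ θ, ‖circleMap 0 R₂ θ‖ = R₂ := fun θ => by
    rw [norm_circleMap_zero, abs_of_pos h₂]
  rw [← oint₂_lambda hp h₂ hR]
  refine oint₂_sub p h₁ h₂ j ?_ ?_
  · unfold dRoot
    refine Continuous.div ((continuous_const.mul (c1.zpow₀ _ fun x => Or.inl ?_)).mul
      (continuous_const.mul (c2.zpow₀ _ fun x => Or.inl ?_))) ((c1.sub c2).pow 2) fun x => ?_
    · exact circleMap_zero_ne_zero h₁ _
    · exact circleMap_zero_ne_zero h₂ _
    · refine pow_ne_zero 2 (sub_ne_zero.mpr fun h => hR.ne ?_)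
      rw [← n1 x.1, h, n2]
  · refine Continuous.div continuous_const (((c1.pow p).sub (c2.pow p)).pow 2) fun x => ?_
    refine pow_ne_zero 2 (sub_ne_zero.mpr fun h => ?_)
    have h := congrArg norm h
    rw [norm_pow, norm_pow, n1, n2] at h
    exact (pow_lt_pow_left₀ hR h₂.le hp.ne').ne' h

/-! ### Exponentials of power series -/

/-- Uniqueness for the differential equation `y' = y h`. -/
theorem powerSeries_ode_unique {y z h : PowerSeries ℂ}
    (hy : PowerSeries.derivative ℂ y = y * h) (hz : PowerSeries.derivative ℂ z = z * h)
    (h0 : PowerSeries.constantCoeff y = PowerSeries.constantCoeff z) : y = z := by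
  ext n
  induction n using Nat.strong_induction_on with
  | _ n ih =>
    rcases n with _ | n
    · simpa using h0
    · have h1 := congrArg (PowerSeries.coeff n) hy
      have h2 := congrArg (PowerSeries.coeff n) hz
      rw [PowerSeries.coeff_derivative, PowerSeries.coeff_mul] at h1 h2
      -- The equation expresses n + 1 times the coefficient of order n + 1 through coefficients of
      -- order at most n.
      have h3 : (n + 1 : ℂ) ≠ 0 := by exact_mod_cast n.succ_ne_zero
      refine mul_right_cancel₀ h3 (h1.trans (Eq.trans ?_ h2.symm))
      refine Finset.sum_congr rfl fun x hx => ?_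
      rw [ih x.1 (by have := Finset.HasAntidiagonal.mem_antidiagonal.mp hx; omega)]

theorem constantCoeff_exp_subst {τ : Type*} {f : MvPowerSeries τ ℂ}
    (hf : MvPowerSeries.constantCoeff f = 0) :
    MvPowerSeries.constantCoeff ((PowerSeries.exp ℂ).subst f) = 1 := by
  rw [PowerSeries.constantCoeff_subst (PowerSeries.HasSubst.of_constantCoeff_zero hf),
    finsum_eq_single _ 0]
  · simp
  · intro n hn
    simp [hf, hn]

theorem derivative_exp_subst {f : PowerSeries ℂ} (hf : PowerSeries.constantCoeff f = 0) :
    PowerSeries.derivative ℂ ((PowerSeries.exp ℂ).subst f) =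
      (PowerSeries.exp ℂ).subst f * PowerSeries.derivative ℂ f := by
  rw [PowerSeries.derivative_subst (PowerSeries.HasSubst.of_constantCoeff_zero' hf),
    PowerSeries.derivative_exp]

/-- Both sides solve y' = y/(1 + X) with constant term 1. -/
theorem exp_subst_log : (PowerSeries.exp ℂ).subst (PowerSeries.log ℂ) = 1 + PowerSeries.X := by
  refine powerSeries_ode_unique (derivative_exp_subst PowerSeries.constantCoeff_log) ?_ ?_
  · rw [PowerSeries.deriv_log]
    ext n
    rw [add_mul, one_mul, map_add (PowerSeries.derivative ℂ), PowerSeries.derivative_X,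
      PowerSeries.derivative_one, zero_add, map_add, PowerSeries.coeff_one]
    rcases n with _ | n
    · simp
    · rw [PowerSeries.coeff_succ_X_mul]
      simp [pow_succ]
  · exact (constantCoeff_exp_subst PowerSeries.constantCoeff_log).trans (by simp)

/-- Both sides solve y' = y (f + h)' with constant term 1. -/
theorem exp_subst_add {f h : PowerSeries ℂ} (hf : PowerSeries.constantCoeff f = 0)
    (hh : PowerSeries.constantCoeff h = 0) :
    (PowerSeries.exp ℂ).subst (f + h) =
      (PowerSeries.exp ℂ).subst f * (PowerSeries.exp ℂ).subst h := by
  refine powerSeries_ode_unique (derivative_exp_subst (by simp [hf, hh])) ?_ ?_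
  · rw [Derivation.leibniz, derivative_exp_subst hf, derivative_exp_subst hh, map_add]
    simp only [smul_eq_mul]
    ring
  · rw [map_mul]
    have hfh : PowerSeries.constantCoeff (f + h) = 0 := by simp [hf, hh]
    exact (constantCoeff_exp_subst hfh).trans (by
        have h1 : PowerSeries.constantCoeff ((PowerSeries.exp ℂ).subst f) = (1 : ℂ) :=
          constantCoeff_exp_subst hf
        have h2 : PowerSeries.constantCoeff ((PowerSeries.exp ℂ).subst h) = (1 : ℂ) :=
          constantCoeff_exp_subst hh
        rw [h1, h2, one_mul])

theorem exp_subst_log_subst {τ : Type*} {Z : MvPowerSeries τ ℂ}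
    (hZ : MvPowerSeries.constantCoeff Z = 1) :
    (PowerSeries.exp ℂ).subst ((PowerSeries.log ℂ).subst (Z - 1)) = Z := by
  have h : PowerSeries.HasSubst (Z - 1) :=
    PowerSeries.HasSubst.of_constantCoeff_zero (by rw [map_sub, hZ, map_one, sub_self])
  rw [← PowerSeries.subst_comp_subst_apply PowerSeries.HasSubst.log h, exp_subst_log,
    PowerSeries.subst_add h, PowerSeries.subst_X h, ← PowerSeries.coe_substAlgHom h, map_one]
  ring

/-! ### Formal differentiation of operator-valued series -/

/-- The derivative of a power series over a ring that need not be commutative. -/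
def seriesDeriv {A : Type*} [Ring A] (f : PowerSeries A) : PowerSeries A :=
  PowerSeries.mk fun n => (n + 1 : ℕ) • PowerSeries.coeff (n + 1) f

theorem seriesDeriv_mul {A : Type*} [Ring A] (f h : PowerSeries A) :
    seriesDeriv (f * h) = seriesDeriv f * h + f * seriesDeriv h := by
  ext n
  simp only [seriesDeriv, PowerSeries.coeff_mk, map_add, PowerSeries.coeff_mul]
  have e1 : ∑ x ∈ Finset.HasAntidiagonal.antidiagonal n,
      (x.1 + 1 : ℕ) • PowerSeries.coeff (x.1 + 1) f * PowerSeries.coeff x.2 h =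
      ∑ x ∈ Finset.HasAntidiagonal.antidiagonal (n + 1),
        x.1 • (PowerSeries.coeff x.1 f * PowerSeries.coeff x.2 h) := by
    rw [Finset.Nat.sum_antidiagonal_succ, zero_smul, zero_add]
    simp only [smul_mul_assoc]
  have e2 : ∑ x ∈ Finset.HasAntidiagonal.antidiagonal n,
      PowerSeries.coeff x.1 f * ((x.2 + 1 : ℕ) • PowerSeries.coeff (x.2 + 1) h) =
      ∑ x ∈ Finset.HasAntidiagonal.antidiagonal (n + 1),
        x.2 • (PowerSeries.coeff x.1 f * PowerSeries.coeff x.2 h) := by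
    rw [Finset.Nat.sum_antidiagonal_succ', zero_smul, zero_add]
    simp only [mul_smul_comm]
  rw [e1, e2, ← Finset.sum_add_distrib, Finset.smul_sum]
  refine Finset.sum_congr rfl fun x hx => ?_
  rw [← add_smul, Finset.HasAntidiagonal.mem_antidiagonal.mp hx]

/-! ### Wick's theorem for ordered exponentials -/

section Wick

variable {V : Type*} [AddCommGroup V] [Module ℂ V]

theorem coeff_expOp (A : Module.End ℂ V) (n : ℕ) :
    PowerSeries.coeff n (expOp A) = ((n ! : ℂ))⁻¹ • A ^ n := PowerSeries.coeff_mk _ _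

theorem succ_smul_factorial_inv (n : ℕ) (x : V) :
    (n + 1 : ℕ) • (((n + 1) ! : ℕ) : ℂ)⁻¹ • x = ((n ! : ℂ))⁻¹ • x := by
  rw [← Nat.cast_smul_eq_nsmul ℂ, smul_smul]
  congr 1
  have h2 : (n ! : ℂ) ≠ 0 := by exact_mod_cast n.factorial_ne_zero
  have h3 : (n + 1 : ℂ) ≠ 0 := by exact_mod_cast n.succ_ne_zero
  rw [Nat.factorial_succ]
  push_cast
  field_simp

theorem seriesDeriv_expOp (A : Module.End ℂ V) :
    seriesDeriv (expOp A) = PowerSeries.C A * expOp A := by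
  ext1 n
  rw [seriesDeriv, PowerSeries.coeff_mk, PowerSeries.coeff_C_mul, coeff_expOp, coeff_expOp,
    succ_smul_factorial_inv, pow_succ', mul_smul_comm]

/-- Since [M, P] is a scalar, ad M acts on functions of P as σ d/dP, which on exp(tP) is
multiplication by σt. -/
theorem expOp_mul_C {P M : Module.End ℂ V} {σ : ℂ} (h : M * P - P * M = σ • 1) :
    expOp P * PowerSeries.C M =
      PowerSeries.C M * expOp P - PowerSeries.C (σ • 1) * (PowerSeries.X * expOp P) := by
  ext1 n
  rw [map_sub, PowerSeries.coeff_mul_C, PowerSeries.coeff_C_mul, PowerSeries.coeff_C_mul]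
  rcases n with _ | n
  · simp [coeff_expOp]
  · rw [PowerSeries.coeff_succ_X_mul, coeff_expOp, coeff_expOp, mul_smul_comm,
      mul_pow_of_commutator h, smul_add, smul_mul_assoc, smul_mul_assoc, one_mul,
      ← succ_smul_factorial_inv n (P ^ n), ← Nat.cast_smul_eq_nsmul ℂ]
    push_cast
    module

theorem seriesDeriv_gaussian (c : ℂ) :
    seriesDeriv (gaussian (V := V) c) =
      PowerSeries.C ((2 * c) • 1) * (PowerSeries.X * gaussian c) := by
  have hc : PowerSeries.constantCoeff (PowerSeries.C c * PowerSeries.X ^ 2 : PowerSeries ℂ) = 0 := by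
    simp
  have h := derivative_exp_subst hc
  have hd : PowerSeries.derivative ℂ (PowerSeries.C c * PowerSeries.X ^ 2 : PowerSeries ℂ) =
      PowerSeries.C (2 * c) * PowerSeries.X := by
    rw [Derivation.leibniz, PowerSeries.derivative_pow, PowerSeries.derivative_X,
      PowerSeries.derivative_C]
    simp only [smul_eq_mul, map_mul, mul_zero, add_zero, map_ofNat]
    ring
  set G := (PowerSeries.exp ℂ).subst (PowerSeries.C c * PowerSeries.X ^ 2 : PowerSeries ℂ)
  rw [hd, mul_left_comm] at h
  ext1 n
  have hn := congrArg (PowerSeries.coeff n) h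
  rw [PowerSeries.coeff_derivative, PowerSeries.coeff_C_mul, mul_comm G] at hn
  have e : (PowerSeries.X * gaussian (V := V) c) =
      PowerSeries.map (algebraMap ℂ (Module.End ℂ V)) (PowerSeries.X * G) := by
    rw [map_mul, PowerSeries.map_X]
    rfl
  have e' : gaussian (V := V) c = PowerSeries.map (algebraMap ℂ (Module.End ℂ V)) G := rfl
  rw [seriesDeriv, PowerSeries.coeff_mk, PowerSeries.coeff_C_mul, e, e', PowerSeries.coeff_map,
    PowerSeries.coeff_map, ← Nat.cast_smul_eq_nsmul ℂ, smul_mul_assoc, one_mul,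
    Algebra.algebraMap_eq_smul_one, Algebra.algebraMap_eq_smul_one, smul_smul, smul_smul]
  congr 1
  push_cast
  linear_combination hn

/-- The coefficients of `gaussian` are scalar operators. -/
theorem commute_gaussian (c : ℂ) (f : PowerSeries (Module.End ℂ V)) :
    Commute (gaussian c) f := by
  ext1 n
  rw [PowerSeries.coeff_mul, PowerSeries.coeff_mul, ← Finset.Nat.sum_antidiagonal_swap]
  refine Finset.sum_congr rfl fun x _ => ?_
  simp only [gaussian, PowerSeries.coeff_map, Prod.fst_swap, Prod.snd_swap]
  exact Algebra.commutes _ _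

/-- The differential equation of the ordered exponential when `[M, P]` is a scalar. -/
theorem seriesDeriv_ordered_exp {P M : Module.End ℂ V} {σ : ℂ} (h : M * P - P * M = σ • 1)
    (c : ℂ) :
    seriesDeriv (gaussian c * (expOp P * expOp M)) =
      PowerSeries.C (P + M) * (gaussian c * (expOp P * expOp M)) +
        PowerSeries.C ((2 * c - σ) • 1) *
          (PowerSeries.X * (gaussian c * (expOp P * expOp M))) := by
  rw [seriesDeriv_mul, seriesDeriv_mul, seriesDeriv_gaussian, seriesDeriv_expOp,
    seriesDeriv_expOp]
  have h1 : expOp P * (PowerSeries.C M * expOp M) = PowerSeries.C M * (expOp P * expOp M) -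
      PowerSeries.C (σ • 1) * (PowerSeries.X * (expOp P * expOp M)) := by
    rw [← mul_assoc, expOp_mul_C h, sub_mul]
    simp only [mul_assoc]
  set g : PowerSeries (Module.End ℂ V) := gaussian c
  have h2 : g * (PowerSeries.C P * expOp P * expOp M) =
      PowerSeries.C P * (g * (expOp P * expOp M)) := by
    rw [mul_assoc, (commute_gaussian c (PowerSeries.C P)).left_comm]
  have h3 : g * (PowerSeries.C M * (expOp P * expOp M)) =
      PowerSeries.C M * (g * (expOp P * expOp M)) :=
    (commute_gaussian c (PowerSeries.C M)).left_comm _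
  have h4 : g * (PowerSeries.C (σ • 1) * (PowerSeries.X * (expOp P * expOp M))) =
      PowerSeries.C (σ • 1) * (PowerSeries.X * (g * (expOp P * expOp M))) := by
    have c1 : Commute g (PowerSeries.C (σ • (1 : Module.End ℂ V))) := commute_gaussian c _
    have c2 : Commute g (PowerSeries.X : PowerSeries (Module.End ℂ V)) := commute_gaussian c _
    rw [c1.left_comm, c2.left_comm]
  have h5 : PowerSeries.C ((2 * c) • 1) * (PowerSeries.X * g) * (expOp P * expOp M) =
      PowerSeries.C ((2 * c) • 1) * (PowerSeries.X * (g * (expOp P * expOp M))) := by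
    rw [mul_assoc, mul_assoc]
  rw [h1, mul_add, mul_sub, h2, h3, h4, h5, sub_smul, map_add, map_sub, add_mul, sub_mul]
  abel

/-- The normal-ordered exponential of `P + M` as an ordered product, when `[M, P]` is a scalar. -/
theorem wickPow_eq {A P M : Module.End ℂ V} {σ κ : ℂ} (hA : A = P + M)
    (h : M * P - P * M = σ • 1) (N : ℕ) :
    ((N ! : ℂ))⁻¹ • wickPow A κ N =
      PowerSeries.coeff N (gaussian (1 / 2 * (σ - κ)) * (expOp P * expOp M)) := by
  set G := gaussian (1 / 2 * (σ - κ)) * (expOp P * expOp M) with hG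
  have hd := seriesDeriv_ordered_exp h (1 / 2 * (σ - κ))
  -- The Gaussian exponent is chosen so that the equation for G becomes G' = A G - κ t G, whose
  -- coefficients obey Wick's recursion.
  rw [← hG, ← hA, show 2 * (1 / 2 * (σ - κ)) - σ = -κ by ring] at hd
  have h0 : PowerSeries.coeff 0 G = 1 := by
    have h2 : PowerSeries.constantCoeff (gaussian (V := V) (1 / 2 * (σ - κ))) = 1 := by
      have h3 : PowerSeries.constantCoeff ((PowerSeries.exp ℂ).subst
          (PowerSeries.C (1 / 2 * (σ - κ)) * PowerSeries.X ^ 2 : PowerSeries ℂ)) = 1 :=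
        constantCoeff_exp_subst (by
          change PowerSeries.constantCoeff (PowerSeries.C _ * PowerSeries.X ^ 2 : PowerSeries ℂ) = 0
          simp)
      rw [gaussian, ← PowerSeries.coeff_zero_eq_constantCoeff_apply, PowerSeries.coeff_map,
        PowerSeries.coeff_zero_eq_constantCoeff_apply, h3, map_one]
    have h4 : ∀ B : Module.End ℂ V, PowerSeries.constantCoeff (expOp B) = 1 := fun B => by
      rw [← PowerSeries.coeff_zero_eq_constantCoeff_apply, coeff_expOp]
      simp
    rw [PowerSeries.coeff_zero_eq_constantCoeff_apply, hG, map_mul, map_mul, h2, h4, h4]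
    simp
  have h1 : PowerSeries.coeff 1 G = A := by
    have := congrArg (PowerSeries.coeff 0) hd
    rw [seriesDeriv, PowerSeries.coeff_mk, map_add, PowerSeries.coeff_C_mul,
      PowerSeries.coeff_C_mul, PowerSeries.coeff_zero_X_mul, h0] at this
    simpa using this
  have hrec : ∀ n, (n + 1 + 1 : ℕ) • PowerSeries.coeff (n + 1 + 1) G =
      A * PowerSeries.coeff (n + 1) G - κ • PowerSeries.coeff n G := by
    intro n
    have := congrArg (PowerSeries.coeff (n + 1)) hd
    rw [seriesDeriv, PowerSeries.coeff_mk, map_add, PowerSeries.coeff_C_mul,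
      PowerSeries.coeff_C_mul, PowerSeries.coeff_succ_X_mul, smul_mul_assoc, one_mul] at this
    rw [this, neg_smul, sub_eq_add_neg]
  -- Wick's recursion is of second order, so two consecutive coefficients are compared at a time.
  suffices hs : ∀ N : ℕ, ((N ! : ℂ))⁻¹ • wickPow A κ N = PowerSeries.coeff N G ∧
      (((N + 1) ! : ℕ) : ℂ)⁻¹ • wickPow A κ (N + 1) = PowerSeries.coeff (N + 1) G from (hs N).1
  intro N
  induction N with
  | zero => exact ⟨by simp [wickPow, h0], by simp [wickPow, h1]⟩
  | succ N ih =>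
    refine ⟨ih.2, ?_⟩
    have h2 := hrec N
    have h3 : ((N + 1 + 1 : ℕ) : ℂ) ≠ 0 := by exact_mod_cast (N + 1).succ_ne_zero
    have h4 : (((N + 1 + 1 : ℕ) : ℂ)) • PowerSeries.coeff (N + 1 + 1) G =
        (((N + 1 + 1 : ℕ) : ℂ)) • (((N + 1 + 1) ! : ℕ) : ℂ)⁻¹ • wickPow A κ (N + 1 + 1) := by
      rw [Nat.cast_smul_eq_nsmul, Nat.cast_smul_eq_nsmul, h2, succ_smul_factorial_inv, ← ih.1,
        ← ih.2, wickPow, smul_sub, mul_smul_comm, ← succ_smul_factorial_inv N (wickPow A κ N),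
        ← Nat.cast_smul_eq_nsmul ℂ]
      push_cast
      module
    exact (smul_right_injective _ h3 h4).symm

end Wick

/-! ### Words and their content -/

section Words

variable {ι : Type*}

/-- The content of a word, as a multi-index. -/
def content {N : ℕ} (n : Fin N → ι) : ι →₀ ℕ := ∑ i, Finsupp.single (n i) 1

theorem content_prod {N : ℕ} (n : Fin N → ι) (x : ι → ℂ) :
    ((content n).prod fun i k => x i ^ k) = ∏ i, x (n i) := by
  unfold content
  rw [← Finsupp.prod_finsetSum_index (by simp) (by intros; exact pow_add _ _ _)]
  exact Finset.prod_congr rfl fun i _ => by rw [Finsupp.prod_single_index] <;> simp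

theorem content_mem [DecidableEq ι] {N : ℕ} {s : Finset ι} {n : Fin N → ι}
    (hn : n ∈ Fintype.piFinset fun _ => s) : content n ∈ s.finsuppAntidiag N := by
  rw [Finset.mem_finsuppAntidiag]
  have hs : (content n).support ⊆ s := by
    refine Finsupp.support_finsetSum.trans fun i hi => ?_
    obtain ⟨k, -, hk⟩ := Finset.mem_biUnion.mp hi
    have h := Finsupp.support_single_subset hk
    rw [Finset.mem_singleton] at h
    exact h ▸ Fintype.mem_piFinset.mp hn k
  refine ⟨?_, hs⟩
  unfold content
  simp only [Finsupp.coe_finsetSum, Finset.sum_apply]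
  rw [Finset.sum_comm, Finset.sum_congr rfl (g := fun _ => 1)]
  · simp
  · intro k _
    rw [Finset.sum_eq_single (n k)]
    · simp
    · intro i _ hi
      exact Finsupp.single_eq_of_ne hi
    · intro h
      exact absurd (Fintype.mem_piFinset.mp hn k) h

/-- The number of words of a given content is the multinomial coefficient. -/
theorem sum_content [DecidableEq ι] (s : Finset ι) (N : ℕ) (H : (ι →₀ ℕ) → ℂ) :
    ∑ n ∈ Fintype.piFinset (fun _ : Fin N => s), H (content n) =
      ∑ d ∈ s.finsuppAntidiag N, (Nat.multinomial s d : ℂ) * H d := by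
  -- The linear functional sending the monomial of exponent d to H d. Applied to (Σ X_i)^N, expanded
  -- once over words and once by the multinomial theorem, it gives both sides.
  set L := (MvPolynomial.basisMonomials ι ℂ).constr ℂ H
  have hL : ∀ d, L (MvPolynomial.monomial d 1) = H d := fun d => by
    have := (MvPolynomial.basisMonomials ι ℂ).constr_basis ℂ H d
    rwa [MvPolynomial.coe_basisMonomials] at this
  have h := Finset.sum_pow_eq_sum_piAntidiag s (fun i => (MvPolynomial.X i : MvPolynomial ι ℂ)) N
  rw [Finset.sum_pow'] at h
  have h1 := congrArg L h
  rw [map_sum, map_sum] at h1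
  have e1 : ∀ n : Fin N → ι, ∏ i, (MvPolynomial.X (n i) : MvPolynomial ι ℂ) =
      MvPolynomial.monomial (content n) 1 := fun n => by
    unfold content
    rw [MvPolynomial.monomial_sum_one]
    rfl
  simp only [e1, hL] at h1
  rw [h1]
  symm
  refine Finset.sum_nbij (fun d => ⇑d) ?_ ?_ ?_ ?_
  · intro d hd
    rw [Finset.mem_finsuppAntidiag] at hd
    rw [Finset.mem_piAntidiag]
    exact ⟨hd.1, fun i hi => hd.2 (Finsupp.mem_support_iff.mpr hi)⟩
  · exact fun d _ d' _ h => DFunLike.coe_injective h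
  · intro k hk
    rw [Finset.mem_coe, Finset.mem_piAntidiag] at hk
    refine ⟨Finsupp.onFinset s k hk.2, ?_, rfl⟩
    rw [Finset.mem_coe, Finset.mem_finsuppAntidiag]
    exact ⟨hk.1, Finsupp.support_onFinset_subset⟩
  · intro d hd
    rw [Finset.mem_finsuppAntidiag] at hd
    have e2 : ∏ i ∈ s, (MvPolynomial.X i : MvPolynomial ι ℂ) ^ d i =
        MvPolynomial.monomial d 1 := by
      conv_rhs => rw [← Finsupp.sum_single d, Finsupp.sum_of_support_subset d hd.2 _ (by simp),
        MvPolynomial.monomial_sum_one]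
      exact Finset.prod_congr rfl fun i _ => MvPolynomial.X_pow_eq_monomial
    rw [e2, ← nsmul_eq_mul, ← nsmul_eq_mul, map_nsmul, hL]

theorem coe_ofFn_eq_toMultiset {N : ℕ} (n : Fin N → ι) :
    (List.ofFn n : Multiset ι) = Finsupp.toMultiset (content n) := by
  unfold content
  rw [map_sum, ← Fin.univ_val_map]
  simp only [Finsupp.toMultiset_single, one_smul]
  exact (Multiset.sum_map_singleton (Finset.univ.val.map n)).symm.trans
    (by rw [Multiset.map_map]; rfl)

/-- Sums over the words of a given content. -/
theorem finsum_words [DecidableEq ι] {N : ℕ} {s : Finset ι} {d : ι →₀ ℕ} (hd : d ∈ s.finsuppAntidiag N)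
    (f : List ι → ℂ) :
    ∑ᶠ (w : List ι) (_ : (w : Multiset ι) = Finsupp.toMultiset d), f w =
      ∑ n ∈ Fintype.piFinset (fun _ : Fin N => s) with content n = d, f (List.ofFn n) := by
  rw [← finsum_mem_coe_finset]
  symm
  refine finsum_mem_eq_of_bijOn (t := {w : List ι | (w : Multiset ι) = Finsupp.toMultiset d})
    List.ofFn ⟨?_, ?_, ?_⟩ fun _ _ => rfl
  · intro n hn
    have := (Finset.mem_filter.mp (Finset.mem_coe.mp hn)).2
    change (List.ofFn n : Multiset ι) = _
    rw [coe_ofFn_eq_toMultiset, this]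
  · exact fun n _ n' _ h => List.ofFn_injective h
  · intro w hw
    change (w : Multiset ι) = _ at hw
    rw [Finset.mem_finsuppAntidiag] at hd
    have hlen : w.length = N := by
      rw [← Multiset.coe_card, hw, Finsupp.card_toMultiset, ← hd.1,
        Finsupp.sum_of_support_subset d hd.2 _ (by simp)]
      rfl
    subst hlen
    refine ⟨w.get, ?_, List.ofFn_get w⟩
    rw [Finset.mem_coe, Finset.mem_filter]
    refine ⟨Fintype.mem_piFinset.mpr fun i => hd.2 ?_, ?_⟩
    · rw [← Finsupp.mem_toMultiset, ← hw]
      exact List.get_mem w i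
    · rw [← Finsupp.toMultiset_toFinsupp (content _), ← coe_ofFn_eq_toMultiset, List.ofFn_get, hw,
        Finsupp.toMultiset_toFinsupp]

/-- Expansion of a power of a sum of operators into words. -/
theorem sum_smul_pow_apply {V : Type*} [AddCommGroup V] [Module ℂ V] (s : Finset ι) (x : ι → ℂ)
    (A : ι → Module.End ℂ V) (N : ℕ) (v : V) :
    ((∑ i ∈ s, x i • A i) ^ N) v =
      ∑ n ∈ Fintype.piFinset (fun _ : Fin N => s),
        (∏ i, x (n i)) • (List.ofFn n).foldl (fun β i => A i β) v := by
  induction N generalizing v with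
  | zero => simp
  | succ N ih =>
    -- The factor split off is the one acting first on v, matching the first letter consumed by
    -- `foldl`.
    rw [pow_succ, Module.End.mul_apply, LinearMap.sum_apply, map_sum]
    have e : ∀ i, ((∑ i ∈ s, x i • A i) ^ N) ((x i • A i) v) =
        ∑ n ∈ Fintype.piFinset (fun _ : Fin N => s),
          (x i * ∏ k, x (n k)) • (List.ofFn n).foldl (fun β i => A i β) (A i v) := fun i => by
      rw [LinearMap.smul_apply, map_smul, ih, Finset.smul_sum]
      simp only [smul_smul]
    rw [Finset.sum_congr rfl fun i _ => e i, ← Finset.sum_product']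
    refine Finset.sum_nbij' (fun y => Fin.cons y.1 y.2) (fun n => (n 0, Fin.tail n)) ?_ ?_ ?_ ?_ ?_
    · intro y hy
      rw [Finset.mem_product, Fintype.mem_piFinset] at hy
      rw [Fintype.mem_piFinset]
      intro i
      refine Fin.cases ?_ (fun i => ?_) i
      · exact hy.1
      · exact hy.2 i
    · intro n hn
      rw [Fintype.mem_piFinset] at hn
      rw [Finset.mem_product, Fintype.mem_piFinset]
      exact ⟨hn 0, fun i => hn i.succ⟩
    · intro y _
      simp
    · intro n _
      simp
    · intro y _
      simp only [Fin.prod_univ_succ, Fin.cons_zero, Fin.cons_succ, List.ofFn_succ, List.foldl_cons]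

end Words

/-! ### Restriction of a generating function to a line of sources -/

section Line

variable {ι : Type*} [DecidableEq ι]

/-- The substitution `j_i = x_i t`. -/
def line (x : ι → ℂ) (i : ι) : PowerSeries ℂ := PowerSeries.C (x i) * PowerSeries.X

/-- With infinitely many variables, substitution needs all but finitely many of the substituted
series to vanish to any given order; here they vanish outright off s. -/
theorem hasSubst_line {x : ι → ℂ} {s : Finset ι} (hx : ∀ i ∉ s, x i = 0) :
    MvPowerSeries.HasSubst (line x) where
  const_coeff i := by
    have h : PowerSeries.constantCoeff (line x i) = 0 := by simp [line]
    change IsNilpotent (PowerSeries.constantCoeff (line x i))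
    rw [h]
    exact IsNilpotent.zero
  coeff_zero d := s.finite_toSet.subset fun i hi => by
    by_contra h
    apply hi
    rw [line, hx i h, map_zero, zero_mul, map_zero]

theorem coeff_subst_line {x : ι → ℂ} {s : Finset ι} (hx : ∀ i ∉ s, x i = 0)
    (F : MvPowerSeries ι ℂ) (N : ℕ) :
    PowerSeries.coeff N (MvPowerSeries.subst (line x) F : PowerSeries ℂ) =
      ∑ d ∈ s.finsuppAntidiag N, MvPowerSeries.coeff d F * d.prod fun i k => x i ^ k := by
  have e : ∀ d : ι →₀ ℕ, (d.prod fun i k => line x i ^ k) =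
      PowerSeries.C (d.prod fun i k => x i ^ k) * PowerSeries.X ^ (d.sum fun _ k => k) := by
    intro d
    simp only [line, mul_pow, Finsupp.prod, Finsupp.sum, Finset.prod_mul_distrib, map_prod, map_pow,
      Finset.prod_pow_eq_pow_sum]
  have h := MvPowerSeries.coeff_subst (hasSubst_line hx) F (Finsupp.single () N)
  refine h.trans ?_
  have e' : ∀ d : ι →₀ ℕ, MvPowerSeries.coeff (Finsupp.single () N)
      (d.prod fun i k => line x i ^ k) =
      if N = d.sum fun _ k => k then d.prod fun i k => x i ^ k else 0 := by
    intro d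
    rw [e]
    change PowerSeries.coeff N _ = _
    rw [PowerSeries.coeff_C_mul, PowerSeries.coeff_X_pow]
    split_ifs <;> simp
  simp only [e', smul_eq_mul]
  rw [finsum_eq_sum_of_support_subset (s := s.finsuppAntidiag N)]
  · refine Finset.sum_congr rfl fun d hd => ?_
    rw [Finset.mem_finsuppAntidiag] at hd
    rw [if_pos]
    rw [← hd.1, Finsupp.sum_of_support_subset d hd.2 _ (by simp)]
  · intro d hd
    have h1 : N = d.sum fun _ k => k := by
      by_contra h
      exact hd (by simp [h])
    have h2 : (d.prod fun i k => x i ^ k) ≠ 0 := by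
      intro h
      exact hd (by simp [h])
    have h3 : d.support ⊆ s := by
      intro i hi
      by_contra h
      refine h2 (Finset.prod_eq_zero hi ?_)
      beta_reduce
      rw [hx i h, zero_pow (Finsupp.mem_support_iff.mp hi)]
    rw [Finset.mem_coe, Finset.mem_finsuppAntidiag]
    exact ⟨by rw [h1, Finsupp.sum_of_support_subset d h3 _ (by simp)], h3⟩

end Line

/-! ### Microscopic loops -/

section Micro

variable {p q : ℕ} {g : ℂ} {b : ℕ → ℂ}

/-- In `microCorr` the coercion to ℤ falls on the whole list, as a monadic bind. Here it is moved
onto the letters, so that the word expansion of powers applies. -/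
theorem microCorr_eq (Φ : Ket p q g b) (w : List ℕ+) :
    microCorr Φ w = Φ (w.foldl (fun β (n : ℕ+) => alpha p q g b (n : ℤ) β) (bgBra p q g b)) /
      Φ (bgBra p q g b) := by
  have e : (do let a ← w; pure ((a : ℕ) : ℤ)) = w.map fun a : ℕ+ => ((a : ℕ) : ℤ) := by
    simp [← List.map_eq_flatMap]
  unfold microCorr
  rw [e, List.foldl_map]

theorem constantCoeff_microZ {Φ : Ket p q g b} (hne : Φ (bgBra p q g b) ≠ 0) :
    MvPowerSeries.constantCoeff (microZ Φ) = 1 := by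
  change microZ Φ 0 = 1
  have hd : (0 : ℕ+ →₀ ℕ) ∈ (∅ : Finset ℕ+).finsuppAntidiag 0 := by simp
  have h := finsum_words hd fun w => ((w.length ! : ℂ))⁻¹ * microCorr Φ w
  refine h.trans ?_
  simp [microCorr, hne, content]

theorem exp_subst_microF {Φ : Ket p q g b} (hne : Φ (bgBra p q g b) ≠ 0) :
    (PowerSeries.exp ℂ).subst (microF Φ) = microZ Φ :=
  exp_subst_log_subst (constantCoeff_microZ hne)

theorem constantCoeff_microF {Φ : Ket p q g b} (hne : Φ (bgBra p q g b) ≠ 0) :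
    MvPowerSeries.constantCoeff (microF Φ) = 0 :=
  PowerSeries.constantCoeff_subst_eq_zero
    (by rw [map_sub, constantCoeff_microZ hne, map_one, sub_self]) _ PowerSeries.constantCoeff_log

/-- The power of the operator is expanded into words, which are then grouped by content; each group
is one coefficient of `microZ`. -/
theorem coeff_microZ_line (Φ : Ket p q g b) {x : ℕ+ → ℂ} {s : Finset ℕ+}
    (hx : ∀ i ∉ s, x i = 0) (N : ℕ) :
    PowerSeries.coeff N (MvPowerSeries.subst (line x) (microZ Φ) : PowerSeries ℂ) =
      ((N ! : ℂ))⁻¹ * (Φ (((∑ i ∈ s, x i • alpha p q g b (i : ℤ)) ^ N) (bgBra p q g b)) /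
        Φ (bgBra p q g b)) := by
  rw [coeff_subst_line hx, sum_smul_pow_apply, map_sum, Finset.sum_div, Finset.mul_sum,
    ← Finset.sum_fiberwise_of_maps_to (g := content) (t := s.finsuppAntidiag N)
      fun n hn => content_mem hn]
  refine Finset.sum_congr rfl fun d hd => ?_
  have h : MvPowerSeries.coeff d (microZ Φ) = _ :=
    finsum_words hd fun w => ((w.length ! : ℂ))⁻¹ * microCorr Φ w
  rw [h, Finset.sum_mul]
  refine Finset.sum_congr rfl fun n hn => ?_
  rw [← (Finset.mem_filter.mp hn).2, content_prod, map_smul, List.length_ofFn, microCorr_eq,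
    smul_eq_mul]
  ring

/-- Taylor's formula along a line: a content d arises from N!/∏ dᵢ! words, and the factor ∏ dᵢ! is
the one in `microConn` that turns coefficients into derivatives. -/
theorem coeff_microF_line (Φ : Ket p q g b) {x : ℕ+ → ℂ} {s : Finset ℕ+}
    (hx : ∀ i ∉ s, x i = 0) (N : ℕ) :
    PowerSeries.coeff N (MvPowerSeries.subst (line x) (microF Φ) : PowerSeries ℂ) =
      (∑ᶠ n : Fin N → ℕ+, (∏ i, x (n i)) * microConn Φ n) / (N ! : ℂ) := by
  have hN : (N ! : ℂ) ≠ 0 := by exact_mod_cast N.factorial_ne_zero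
  rw [eq_div_iff hN, finsum_eq_sum_of_support_subset (s := Fintype.piFinset fun _ => s)]
  · have h := sum_content s N fun d => (d.prod fun i k => x i ^ k) *
      ((d.prod fun _ k => (k ! : ℂ)) * MvPowerSeries.coeff d (microF Φ))
    simp only [content_prod] at h
    refine Eq.trans ?_ h.symm
    rw [coeff_subst_line hx, Finset.sum_mul]
    refine Finset.sum_congr rfl fun d hd => ?_
    rw [Finset.mem_finsuppAntidiag] at hd
    have hm := Nat.multinomial_spec s d
    rw [hd.1] at hm
    rw [← hm, Finsupp.prod_of_support_subset d hd.2 (fun _ k => (k ! : ℂ)) (by simp)]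
    push_cast
    ring
  · intro n hn
    rw [Finset.mem_coe, Fintype.mem_piFinset]
    intro i
    by_contra h
    exact hn (mul_eq_zero_of_left (Finset.prod_eq_zero (Finset.mem_univ i) (hx _ h)) _)

theorem exp_subst_microF_line {Φ : Ket p q g b} (hne : Φ (bgBra p q g b) ≠ 0) {x : ℕ+ → ℂ}
    {s : Finset ℕ+} (hx : ∀ i ∉ s, x i = 0) :
    (PowerSeries.exp ℂ).subst (MvPowerSeries.subst (line x) (microF Φ) : PowerSeries ℂ) =
      MvPowerSeries.subst (line x) (microZ Φ) := by
  have h1 : MvPowerSeries.HasSubst fun _ : Unit => microF Φ :=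
    MvPowerSeries.hasSubst_of_constantCoeff_zero fun _ => constantCoeff_microF hne
  rw [← exp_subst_microF hne, PowerSeries.subst_def, PowerSeries.subst_def,
    MvPowerSeries.subst_comp_subst_apply h1 (hasSubst_line hx)]

end Micro

/-! ### The smeared boson -/

section Smeared

variable {p : ℕ} (q : ℕ) (g : ℂ) (b : ℕ → ℂ) {R : ℝ} (j : ℤ →₀ ℂ)

theorem smeared_eq (hp : 0 < p) (hR : 0 < R) :
    smeared p q g b R j = ∑ n ∈ j.support, j n • alpha p q g b n := by
  unfold smeared
  simp only [sourceMode_eq hp hR]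
  refine finsum_eq_sum_of_support_subset _ fun n hn => ?_
  by_contra h
  exact hn (by beta_reduce; rw [Finsupp.notMem_support_iff.mp h, zero_smul])

theorem finsum_filter_alpha (P : ℤ → Prop) [DecidablePred P] :
    ∑ᶠ (n : ℤ) (_ : P n), j n • alpha p q g b n =
      ∑ n ∈ j.support with P n, j n • alpha p q g b n := by
  refine finsum_cond_eq_sum_of_cond_iff _ fun {n} hn => ?_
  rw [Finset.mem_filter, Finsupp.mem_support_iff]
  exact ⟨fun h => ⟨fun h' => hn (by rw [h', zero_smul]), h⟩, fun h => h.2⟩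

theorem smearedNeg_eq (hp : 0 < p) (hR : 0 < R) :
    smearedNeg p q g b R j = ∑ n ∈ j.support with n < 0, j n • alpha p q g b n := by
  unfold smearedNeg
  simp only [sourceMode_eq hp hR]
  exact finsum_filter_alpha q g b j fun n => n < 0

theorem smearedPos_eq (hp : 0 < p) (hR : 0 < R) :
    smearedPos p q g b R j = ∑ n ∈ j.support with 0 ≤ n, j n • alpha p q g b n := by
  unfold smearedPos
  simp only [sourceMode_eq hp hR]
  exact finsum_filter_alpha q g b j fun n => 0 ≤ n

theorem smeared_eq_add (hp : 0 < p) (hR : 0 < R) :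
    smeared p q g b R j = smearedPos p q g b R j + smearedNeg p q g b R j := by
  rw [smeared_eq q g b j hp hR, smearedPos_eq q g b j hp hR, smearedNeg_eq q g b j hp hR,
    ← Finset.sum_filter_add_sum_filter_not j.support fun n => 0 ≤ n]
  simp only [not_le]

theorem sum_commutator {V ι κ : Type*} [AddCommGroup V] [Module ℂ V] (s : Finset ι)
    (t : Finset κ) (x : ι → Module.End ℂ V) (y : κ → Module.End ℂ V) :
    (∑ i ∈ s, x i) * (∑ k ∈ t, y k) - (∑ k ∈ t, y k) * (∑ i ∈ s, x i) =
      ∑ i ∈ s, ∑ k ∈ t, (x i * y k - y k * x i) := by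
  rw [Finset.sum_mul_sum, Finset.sum_mul_sum, Finset.sum_comm (s := t)]
  simp only [Finset.sum_sub_distrib]

theorem smul_commutator {V : Type*} [AddCommGroup V] [Module ℂ V] (a c : ℂ)
    (A B : Module.End ℂ V) :
    a • A * c • B - c • B * a • A = (a * c) • (A * B - B * A) := by
  rw [smul_mul_smul_comm, smul_mul_smul_comm, mul_comm c, ← smul_sub]

/-- Each negative mode m pairs only with the mode -m. If -m is not in the support of the source, the
corresponding term of `selfContraction` vanishes as well. -/
theorem smeared_commutator (hp : 0 < p) (hR : 0 < R) :
    smearedNeg p q g b R j * smearedPos p q g b R j -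
      smearedPos p q g b R j * smearedNeg p q g b R j = selfContraction j • 1 := by
  rw [smearedPos_eq q g b j hp hR, smearedNeg_eq q g b j hp hR]
  refine (sum_commutator _ _ _ _).trans ?_
  have e : selfContraction j = ∑ m ∈ j.support with m < 0, -(m : ℂ) * j m * j (-m) := by
    rw [selfContraction, Finset.sum_filter]
    exact Finset.sum_congr rfl fun k _ => by split_ifs <;> simp
  rw [e, Finset.sum_smul]
  refine Finset.sum_congr rfl fun m hm => ?_
  have e1 : ∀ n ∈ j.support.filter fun n => 0 ≤ n,
      j m • alpha p q g b m * j n • alpha p q g b n - j n • alpha p q g b n * j m • alpha p q g b m =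
      if n = -m then (-(m : ℂ) * j m * j (-m)) • (1 : Module.End ℂ (braSpace p q g b)) else 0 := by
    intro n _
    have h := alpha_commutator p q g b m n
    rw [smul_commutator, h, smul_smul]
    by_cases hn : n = -m
    · subst hn
      rw [if_pos (by omega), if_pos rfl]
      congr 1
      push_cast
      ring
    · rw [if_neg (by omega), if_neg hn, mul_zero, zero_smul]
  refine (Finset.sum_congr rfl e1).trans ?_
  rw [Finset.sum_ite_eq']
  split_ifs with h
  · rfl
  · have : j (-m) = 0 := by
      by_contra h'
      refine h (Finset.mem_filter.mpr ⟨Finsupp.mem_support_iff.mpr h', ?_⟩)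
      have := (Finset.mem_filter.mp hm).2
      omega
    rw [this, mul_zero, zero_smul]

/-- The eigenvalues of the negative modes on the coherent bra, weighted by the source modes, add up
to the residue sum of the disk term. -/
theorem smearedNeg_bgBra (hp : 0 < p) (hR : 0 < R) :
    smearedNeg p q g b R j (bgBra p q g b) =
      (g⁻¹ * oint p R fun z => source j z * N₁ p q b z) • bgBra p q g b := by
  rw [smearedNeg_eq q g b j hp hR, oint_N₁ hp q b hR, LinearMap.sum_apply]
  have e1 : ∀ m ∈ j.support.filter fun m => m < 0,
      (j m • alpha p q g b m) (bgBra p q g b) =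
        (coherentEigenvalue p q g b (-m).toNat * j m) • bgBra p q g b := by
    intro m hm
    have hm' := (Finset.mem_filter.mp hm).2
    have h := alpha_neg_bgBra p q g b (-m).toNat
    rw [show -((-m).toNat : ℤ) = m by omega] at h
    rw [LinearMap.smul_apply, h, smul_smul, mul_comm]
  rw [Finset.sum_congr rfl e1, ← Finset.sum_smul]
  congr 1
  unfold coherentEigenvalue
  simp only [mul_assoc, ← Finset.mul_sum]
  congr 1
  simp only [ite_mul, zero_mul]
  rw [← Finset.sum_filter]
  -- The sums run over modes of the source and over modes of the background; only the nonzero terms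
  -- correspond, through m = -n.
  refine Finset.sum_bij_ne_zero (fun m _ _ => (-m).toNat) ?_ ?_ ?_ ?_
  · exact fun m hm _ => (Finset.mem_filter.mp hm).2
  · intro m hm _ m' hm' _ h
    have h1 := (Finset.mem_filter.mp (Finset.mem_filter.mp hm).1).2
    have h2 := (Finset.mem_filter.mp (Finset.mem_filter.mp hm').1).2
    omega
  · intro n hn h
    have hj : j (-(n : ℤ)) ≠ 0 := fun h' => h (by rw [h', mul_zero, mul_zero])
    have hn' := (Finset.mem_Icc.mp hn).1
    refine ⟨-(n : ℤ), ?_, ?_, by simp⟩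
    · simp only [Finset.mem_filter, Finsupp.mem_support_iff, neg_neg, Int.toNat_natCast]
      exact ⟨⟨hj, by omega⟩, hn⟩
    · simpa [and_assoc] using h
  · intro m hm _
    have h1 := (Finset.mem_filter.mp (Finset.mem_filter.mp hm).1).2
    rw [mul_assoc, show -((-m).toNat : ℤ) = m by omega]

theorem pow_smearedNeg_bgBra (hp : 0 < p) (hR : 0 < R) (N : ℕ) :
    (smearedNeg p q g b R j ^ N) (bgBra p q g b) =
      (g⁻¹ * oint p R fun z => source j z * N₁ p q b z) ^ N • bgBra p q g b := by
  induction N with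
  | zero => simp
  | succ N ih =>
    rw [pow_succ', Module.End.mul_apply, ih, map_smul, smearedNeg_bgBra q g b j hp hR, smul_smul,
      pow_succ]

theorem coeff_expOp_smearedNeg_bgBra (hp : 0 < p) (hR : 0 < R) (N : ℕ) :
    PowerSeries.coeff N (expOp (smearedNeg p q g b R j)) (bgBra p q g b) =
      PowerSeries.coeff N (PowerSeries.rescale
        (g⁻¹ * oint p R fun z => source j z * N₁ p q b z) (PowerSeries.exp ℂ)) •
        bgBra p q g b := by
  rw [coeff_expOp, LinearMap.smul_apply, pow_smearedNeg_bgBra q g b j hp hR,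
    PowerSeries.coeff_rescale, PowerSeries.coeff_exp, smul_smul]
  congr 1
  rw [mul_comm]
  simp

/-- The positive labels of the modes of a source. -/
def posSupport : Finset ℕ+ :=
  j.support.preimage (fun n : ℕ+ => ((n : ℕ) : ℤ)) fun _ _ _ _ h =>
    PNat.coe_injective (Int.ofNat_injective h)

theorem notMem_posSupport {j : ℤ →₀ ℂ} {n : ℕ+} (h : n ∉ posSupport j) : j (n : ℤ) = 0 := by
  by_contra h'
  exact h (Finset.mem_preimage.mpr (Finsupp.mem_support_iff.mpr h'))

theorem smearedPos_eq_add (hp : 0 < p) (hR : 0 < R) :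
    smearedPos p q g b R j = j 0 • alpha p q g b 0 +
      ∑ n ∈ posSupport j, j (n : ℤ) • alpha p q g b (n : ℤ) := by
  classical
  have h0 : (0 : ℤ) ∉ (posSupport j).image fun n : ℕ+ => ((n : ℕ) : ℤ) := by
    intro h
    obtain ⟨n, -, hn⟩ := Finset.mem_image.mp h
    exact n.pos.ne' (by exact_mod_cast hn)
  rw [smearedPos_eq q g b j hp hR, ← Finset.sum_image (s := posSupport j)
    (g := fun n : ℕ+ => ((n : ℕ) : ℤ)) (f := fun n : ℤ => j n • alpha p q g b n)
    fun _ _ _ _ h => PNat.coe_injective (Int.ofNat_injective h),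
    ← Finset.sum_insert (f := fun n : ℤ => j n • alpha p q g b n) h0]
  refine Finset.sum_subset (fun n hn => ?_) fun n hn hn' => ?_
  · obtain ⟨h1, h2⟩ := Finset.mem_filter.mp hn
    rcases h2.eq_or_lt with rfl | h3
    · exact Finset.mem_insert_self _ _
    · have e : ((n.toNat : ℕ) : ℤ) = n := Int.toNat_of_nonneg h2
      refine Finset.mem_insert_of_mem (Finset.mem_image.mpr ⟨⟨n.toNat, by omega⟩, ?_, e⟩)
      exact Finset.mem_preimage.mpr (by rw [PNat.mk_coe, e]; exact h1)
  · have h : j n = 0 := by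
      by_contra h
      refine hn' (Finset.mem_filter.mpr ⟨Finsupp.mem_support_iff.mpr h, ?_⟩)
      rcases Finset.mem_insert.mp hn with rfl | h'
      · exact le_rfl
      · obtain ⟨m, -, rfl⟩ := Finset.mem_image.mp h'
        exact Int.natCast_nonneg _
    rw [h, zero_smul]

/-- The zero mode drops out on the neutral bra `⟨b/g|`. -/
theorem pow_smearedPos_bgBra (hp : 0 < p) (hR : 0 < R) (N : ℕ) :
    (smearedPos p q g b R j ^ N) (bgBra p q g b) =
      ((∑ n ∈ posSupport j, j (n : ℤ) • alpha p q g b (n : ℤ)) ^ N) (bgBra p q g b) := by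
  rw [smearedPos_eq_add q g b j hp hR]
  set Q := ∑ n ∈ posSupport j, j (n : ℤ) • alpha p q g b (n : ℤ) with hQ
  -- The zero mode commutes with all positive modes, so it can be moved onto ⟨b/g|, where its
  -- eigenvalue is 0.
  have hc : Commute (alpha p q g b 0) Q := by
    refine Commute.sum_right _ _ _ fun n _ => Commute.smul_right ?_ _
    have h := alpha_commutator p q g b 0 (n : ℤ)
    have hn : (n : ℕ) ≠ 0 := n.pos.ne'
    rw [if_neg (by omega), zero_smul] at h
    exact sub_eq_zero.mp h
  have h0 : alpha p q g b 0 (bgBra p q g b) = 0 := by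
    have h := alpha_neg_bgBra p q g b 0
    simpa [coherentEigenvalue] using h
  induction N with
  | zero => simp
  | succ N ih =>
    have h1 : alpha p q g b 0 ((Q ^ N) (bgBra p q g b)) = 0 := by
      rw [← Module.End.mul_apply, (hc.pow_right N).eq, Module.End.mul_apply, h0,
        LinearMap.map_zero]
    rw [pow_succ', Module.End.mul_apply, ih, LinearMap.add_apply, LinearMap.smul_apply, h1,
      smul_zero, zero_add, pow_succ', Module.End.mul_apply]

end Smeared

/-! ### Macroscopic loops -/

theorem zetaExp_eq {p : ℕ} (q : ℕ) (g : ℂ) (b : ℕ → ℂ) (j : ℤ →₀ ℂ) (hp : 0 < p) {R₁ R₂ : ℝ}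
    (hR₂ : 0 < R₂) (hR : R₂ < R₁) :
    zetaExp p q g b R₁ R₂ j =
      gaussian (1 / 2 * oint₂ p R₁ R₂ j (N₂ p)) * lambdaExp p q g b R₁ j := by
  have hR₁ := hR₂.trans hR
  ext1 N
  rw [zetaExp, PowerSeries.coeff_mk, oint₂_N₂ hp hR₂ hR]
  exact wickPow_eq (smeared_eq_add q g b j hp hR₁) (smeared_commutator q g b j hp hR₁) N

/-- The generating series of connected amplitudes is a sum of the annulus, microscopic and disk
contributions, all without constant term, so its exponential is a product. The middle factor is the
exponential of ln Z along the line, that is, the restriction of `microZ`. -/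
theorem macroZ_factorization {p q : ℕ} {g : ℂ} {b : ℕ → ℂ} {Φ : Ket p q g b}
    (hne : Φ (bgBra p q g b) ≠ 0) (j : ℤ →₀ ℂ) (hp : 0 < p) {R₁ R₂ : ℝ} (hR₁ : 0 < R₁) :
    macroZ Φ R₁ R₂ j =
      (PowerSeries.exp ℂ).subst
          (PowerSeries.C (1 / 2 * oint₂ p R₁ R₂ j (N₂ p)) * PowerSeries.X ^ 2 : PowerSeries ℂ) *
        (MvPowerSeries.subst (line fun n : ℕ+ => j (n : ℤ)) (microZ Φ) *
          PowerSeries.rescale (g⁻¹ * oint p R₁ fun z => source j z * N₁ p q b z)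
            (PowerSeries.exp ℂ)) := by
  have hx : ∀ n ∉ posSupport j, j ((n : ℕ) : ℤ) = 0 := fun n hn => notMem_posSupport hn
  set μ := g⁻¹ * oint p R₁ fun z => source j z * N₁ p q b z with hμ
  set F : PowerSeries ℂ := MvPowerSeries.subst (line fun n : ℕ+ => j (n : ℤ)) (microF Φ) with hF
  set K : PowerSeries ℂ := PowerSeries.C (1 / 2 * oint₂ p R₁ R₂ j (N₂ p)) * PowerSeries.X ^ 2
    with hK
  have hF0 : PowerSeries.constantCoeff F = 0 :=
    MvPowerSeries.constantCoeff_subst_eq_zero (hasSubst_line hx) (fun i => by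
      change PowerSeries.constantCoeff (line _ i) = 0
      simp [line]) (constantCoeff_microF hne)
  have hμ0 : PowerSeries.constantCoeff (μ • PowerSeries.X : PowerSeries ℂ) = 0 := by
    rw [PowerSeries.smul_eq_C_mul]
    simp
  have hK0 : PowerSeries.constantCoeff K = 0 := by simp [hK]
  -- The N = 1 and N = 2 corrections become the linear term μ t and, with 1/2! from the series, the
  -- quadratic term K.
  have e : (PowerSeries.mk fun N => if N = 0 then 0 else macroConn Φ R₁ R₂ j N / (N ! : ℂ)) =
      K + (F + μ • PowerSeries.X) := by
    ext N
    rw [PowerSeries.coeff_mk, map_add, map_add]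
    rcases N with _ | N
    · rw [if_pos rfl, PowerSeries.coeff_zero_eq_constantCoeff_apply,
        PowerSeries.coeff_zero_eq_constantCoeff_apply,
        PowerSeries.coeff_zero_eq_constantCoeff_apply, hF0, hμ0, hK0]
      simp
    · rw [if_neg N.succ_ne_zero, hF, coeff_microF_line Φ hx, macroConn, hK,
        PowerSeries.coeff_C_mul, PowerSeries.coeff_X_pow, PowerSeries.smul_eq_C_mul,
        PowerSeries.coeff_C_mul, PowerSeries.coeff_X]
      simp only [sourceMode_eq hp hR₁]
      by_cases h1 : N + 1 = 1
      · obtain rfl : N = 0 := by omega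
        simp [hμ]
      · by_cases h2 : N + 1 = 2
        · obtain rfl : N = 1 := by omega
          simp
          ring
        · have h3 : N ≠ 0 := by omega
          simp [h3, h2]
  rw [macroZ, e, exp_subst_add hK0 (by rw [map_add, hF0, hμ0, add_zero]),
    exp_subst_add hF0 hμ0, exp_subst_microF_line hne hx, PowerSeries.rescale_eq_subst]

/-- The factors of `macroZ_factorization` and of the ordered exponential correspond one to one, so
the Cauchy products agree term by term. -/
theorem macroZ_eq {p q : ℕ} {g : ℂ} {b : ℕ → ℂ} {Φ : Ket p q g b}
    (hne : Φ (bgBra p q g b) ≠ 0) (j : ℤ →₀ ℂ) (hp : 0 < p) {R₁ R₂ : ℝ}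
    (hR₂ : 0 < R₂) (hR : R₂ < R₁) :
    macroZ Φ R₁ R₂ j = PowerSeries.mk fun N =>
      Φ (PowerSeries.coeff N (zetaExp p q g b R₁ R₂ j) (bgBra p q g b)) /
        Φ (bgBra p q g b) := by
  have hR₁ := hR₂.trans hR
  have hx : ∀ n ∉ posSupport j, j ((n : ℕ) : ℤ) = 0 := fun n hn => notMem_posSupport hn
  ext N
  rw [macroZ_factorization hne j hp hR₁, PowerSeries.coeff_mk, zetaExp_eq q g b j hp hR₂ hR,
    PowerSeries.coeff_mul, PowerSeries.coeff_mul, LinearMap.sum_apply, map_sum, Finset.sum_div]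
  refine Finset.sum_congr rfl fun x _ => ?_
  rw [gaussian, PowerSeries.coeff_map, ← Algebra.smul_def, LinearMap.smul_apply, map_smul,
    smul_eq_mul, mul_div_assoc]
  congr 1
  rw [lambdaExp, PowerSeries.coeff_mul, PowerSeries.coeff_mul, LinearMap.sum_apply, map_sum,
    Finset.sum_div]
  refine Finset.sum_congr rfl fun y _ => ?_
  -- The creation part reaches the bra first and becomes a scalar; the annihilation part then acts
  -- on ⟨b/g| itself and gives the microscopic generating function.
  rw [Module.End.mul_apply, coeff_expOp_smearedNeg_bgBra q g b j hp hR₁, map_smul, map_smul,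
    coeff_expOp, LinearMap.smul_apply, map_smul, pow_smearedPos_bgBra q g b j hp hR₁,
    coeff_microZ_line Φ hx, smul_eq_mul, smul_eq_mul]
  ring

end MinimalString

end

theorem theorem3 (p q : ℕ) (hp : 0 < p) (hq : 0 < q) (g : ℂ) (hg : g ≠ 0) (b : ℕ → ℂ)
    (Φ : MinimalString.Ket p q g b)
    (hdec : MinimalString.IsDecomposable Φ)
    (hW : MinimalString.SatisfiesW Φ)
    (hne : Φ (MinimalString.bgBra p q g b) ≠ 0)
    (j : ℤ →₀ ℂ) (R₁ R₂ : ℝ) (hR₂ : 0 < R₂) (hR : R₂ < R₁) :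
    MinimalString.macroZ Φ R₁ R₂ j =
        PowerSeries.mk (fun N =>
          Φ (PowerSeries.coeff N (MinimalString.zetaExp p q g b R₁ R₂ j)
              (MinimalString.bgBra p q g b)) /
            Φ (MinimalString.bgBra p q g b)) ∧
      MinimalString.zetaExp p q g b R₁ R₂ j =
        MinimalString.gaussian (1 / 2 * MinimalString.oint₂ p R₁ R₂ j (MinimalString.N₂ p)) *
          MinimalString.lambdaExp p q g b R₁ j ∧
      ∀ N : ℕ,
        PowerSeries.coeff N (MinimalString.expOp (MinimalString.smearedNeg p q g b R₁ j))
            (MinimalString.bgBra p q g b) =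
          PowerSeries.coeff N (PowerSeries.rescale
              (g⁻¹ * MinimalString.oint p R₁
                (fun z => MinimalString.source j z * MinimalString.N₁ p q b z))
              (PowerSeries.exp ℂ)) •
            MinimalString.bgBra p q g b :=
  ⟨MinimalString.macroZ_eq hne j hp hR₂ hR, MinimalString.zetaExp_eq q g b j hp hR₂ hR,
    MinimalString.coeff_expOp_smearedNeg_bgBra q g b j hp (hR₂.trans hR)⟩
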